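/- Let $m\ge 9$ be an integer. On $[-1,1]$ let $\varphi_0=1$ and $\varphi_k=\sqrt2\,T_k$ for $1\le k\le m$, where $T_k(x)=\cos(k\arccos x)$ is the $k$-th Chebyshev polynomial of the first kind, and put $\Phi=(\varphi_0,\dots,\varphi_m)$. Let $$\Delta=\sum_{j=1}^{s}\Delta_j e^{\mathrm i\theta_j}\delta_{T_j},\qquad \Delta_j>0,\ \theta_j\in\mathbb R,$$ be a discrete complex measure on $[-1,1]$ with support $\mathbf S=\{T_1,\dots,T_s\}$ (the $T_j$ distinct). Let $c_0>0$ and assume that every point of $\mathbf S$ is at distance at least $2c_0$ from each of $-1$ and $1$. Assume that $\mathbf S$ satisfies $\mathrm{QIC}(C_a,C_b)$ with $C_a>0$, $0<C_b<1$ and $C_b/C_a\le c_0^2$; that is, for all real $\vartheta_1,\dots,\vartheta_s$ there is a complex linear combination $P$ of $\varphi_0,\dots,\varphi_m$ with $P(T_k)=e^{-\mathrm i\vartheta_k}$ for all $k$ and $$1-|P(x)|\ \ge\ \min_{T\in\mathbf S}\min\{C_a m^2|x-T|^2,\;C_b\}\qquad\text{for all }x\in[-1,1].$$ Let $\varepsilon_0,\dots,\varepsilon_m$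 be i.i.d. real centered Gaussian random variables with standard deviation $\sigma>0$, let $y=\int\Phi\,d\Delta+\varepsilon$, and let $$\lambda\ \ge\ \lambda_M:=\sigma\sqrt{6m\log m}.$$ Then, with probability greater than $$1-\frac{8\sqrt6}{\sqrt{2\pi}}\,\frac{\lambda}{\lambda_M}\sqrt{\log m}\;\exp\Big[-\Big(2\frac{\lambda^2}{\lambda_M^2}-1\Big)\log m\Big],$$ the following holds for every solution $\hat\Delta$ of $$\hat\Delta\in\arg\min_{\mu}\ \tfrac12\Big\|\int\Phi\,d\mu-y\Big\|_2^2+\lambda\|\mu\|_{TV},$$ where $\mu$ ranges over all complex Borel measures on $[-1,1]$ and $\|\cdot\|_{TV}$ is the total variation norm. * For every $x\in[-1,1]$ with $|\hat\Delta(\{x\})|>2\lambda/C_b$ there is a unique $T\in\mathbf S$ such that $$|x-T|\le\Big[\frac{2\lambda}{C_a|\hat\Delta(\{x\})|}\Big]^{1/2}\frac1m,$$ and the right-hand side is at most $c_0/m$. * Let $C'=2+\max\Big\{\frac{2(1-C_b)}{C_b},\frac{4}{C_a-C_b}\Big\}$. For every $j$ with $\Delta_j>C'\lambda$ there is $\hat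 T\in\mathrm{Supp}(\hat\Delta)$ such that $$|T_j-\hat T|\le\Big[\frac{2\lambda}{C_a(\Delta_j-C'\lambda)}\Big]^{1/2}\frac1m.$$ -/

import Mathlib

open MeasureTheory ProbabilityTheory

noncomputable section

namespace MomentBlasso

/-- The compact metric space `[-1, 1]`, with `d(x, y) = |x - y|`. -/
abbrev Dom : Type := Set.Icc (-1 : ℝ) 1

/-- The Chebyshev family: `φ₀ = 1` and `φₖ = √2 Tₖ` for `k ≥ 1`, as functions on `[-1, 1]`,
with `Tₖ` the Chebyshev polynomial of the first kind. -/
def cheb (k : ℕ) (x : Dom) : ℝ :=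
  if k = 0 then 1 else Real.sqrt 2 * (Polynomial.Chebyshev.T ℝ (k : ℤ)).eval (x : ℝ)

/-- The complex linear span of `φ₀, …, φₘ`. -/
def chebSpan (m : ℕ) : Submodule ℂ (Dom → ℂ) :=
  Submodule.span ℂ (Set.range fun (k : Fin (m + 1)) (x : Dom) => (cheb k x : ℂ))

/-- The quadratic isolation condition `QIC(Ca, Cb)` for the points `T 1, …, T s`.
The infimum over the finite index set is the minimum over the points. -/
def QIC (m : ℕ) {s : ℕ} (T : Fin s → Dom) (Ca Cb : ℝ) : Prop :=
  0 < Ca ∧ 0 < Cb ∧ Cb < 1 ∧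
    ∀ θ : Fin s → ℝ, ∃ P ∈ chebSpan m,
      (∀ k, P (T k) = Complex.exp (-(Complex.I * (θ k : ℂ)))) ∧
      ∀ x : Dom,
        (⨅ k, min (Ca * (m : ℝ) ^ 2 * dist x (T k) ^ 2) Cb) ≤ 1 - ‖P x‖

/-- The discrete complex measure `∑ₖ aₖ exp(i θₖ) δ_{Tₖ}`. -/
def spikes {s : ℕ} (T : Fin s → Dom) (a θ : Fin s → ℝ) : ComplexMeasure Dom :=
  ∑ k, VectorMeasure.dirac (T k) ((a k : ℂ) * Complex.exp (Complex.I * (θ k : ℂ)))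

/-- The generalized moment `cₖ(μ) = ∫ φₖ dμ`. -/
def moment (k : ℕ) (μ : ComplexMeasure Dom) : ℂ :=
  μ.integral (cheb k) (ContinuousLinearMap.lsmul ℝ ℝ)

/-- The total variation norm of a complex measure. -/
def tvNorm (μ : ComplexMeasure Dom) : ℝ :=
  μ.variation.real Set.univ

/-- The objective `½ ‖∫ Φ dμ - y‖₂² + lam ‖μ‖_TV`. -/
def objective (m : ℕ) (lam : ℝ) (y : Fin (m + 1) → ℂ) (μ : ComplexMeasure Dom) : ℝ :=
  1 / 2 * ∑ k : Fin (m + 1), ‖moment k μ - y k‖ ^ 2 + lam * tvNorm μ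

/-- `μ` is a solution of BLASSO: it minimizes the objective over all complex measures. -/
def IsSolution (m : ℕ) (lam : ℝ) (y : Fin (m + 1) → ℂ) (μ : ComplexMeasure Dom) : Prop :=
  ∀ ν : ComplexMeasure Dom, objective m lam y μ ≤ objective m lam y ν

/-- The topological support of a complex measure. -/
def supp (μ : ComplexMeasure Dom) : Set Dom := μ.variation.support

/-- The threshold `σ √(6 m log m)`. -/
def lamM (m : ℕ) (σ : ℝ) : ℝ := σ * Real.sqrt (6 * m * Real.log m)

/-- The constant `C' = 2 + max {2 (1 - Cb) / Cb, 4 / (Ca - Cb)}`. -/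
def constC' (Ca Cb : ℝ) : ℝ := 2 + max (2 * (1 - Cb) / Cb) (4 / (Ca - Cb))

end MomentBlasso

end

/-!
First-order optimality shows that pairing a solution `μ` with a polynomial `P` of modulus at most
`1` which interpolates the conjugate phases of the spikes leaves a defect `‖μ‖ - Re ∫ P dμ` of at
most `lam`, and that the moments of `μ` are within `2 * lam` of those of the spikes, as soon as the
Euclidean norm of the noise is at most `lam`. Both rest on Bessel's inequality for the orthonormal
Chebyshev system. Where `|P|` is isolated from `1`, the defect bounds the mass of `μ`, which
localizes its large atoms near the spikes.

A spike `T j` of large amplitude is detected by combining `P` with a second polynomial `Q` that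
interpolates the same phases except for the opposite sign at `T j`: if `μ` had no mass near `T j`,
then `|(1 + L) P - Q| ≤ L` would hold on its support, whereas the spikes themselves exceed this
bound by `2 a j`. At the other spikes `P` and `Q` agree, and Bernstein's inequality in the variable
`arccos x`, a consequence of the interpolation formula of M. Riesz, keeps them close nearby. It also
separates the spikes and forces `Cb ≤ 1 / 3`. The noise is controlled by a union bound over the
sub-Gaussian tails of its coordinates.
-/

noncomputable section

namespace MomentBlasso

section Riesz

open Complex Finset
open scoped Real

theorem eq_add_nsmul_of_secondDiff_eq_zero {M : Type*} [AddCommGroup M] {u : ℕ → M} {N : ℕ}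
    (h : ∀ n, n + 2 ≤ N → u (n + 2) - u (n + 1) = u (n + 1) - u n) {n : ℕ} (hn : n ≤ N) :
    u n = u 0 + n • (u 1 - u 0) := by
  have hdiff : ∀ k, k + 1 ≤ N → u (k + 1) - u k = u 1 - u 0 := by
    intro k
    induction k with
    | zero => simp
    | succ k ih => exact fun hk => (h k hk).trans (ih (by lia))
  induction n with
  | zero => simp
  | succ n ih =>
    rw [succ_nsmul, ← add_assoc, ← ih (by lia), ← hdiff n hn, add_sub_cancel]

/-- The `r`-th node `(2r + 1)π / (2m)` of the interpolation formula of M. Riesz for trigonometric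
polynomials of degree `m`; the nodes with `r < 2m` are the zeros of `cos (m t)` in `[0, 2π)`. -/
def rieszNode (m r : ℕ) : ℝ := (2 * r + 1) * π / (2 * m)

/-- The absolute value of the coefficient of the `r`-th node in the interpolation formula of
M. Riesz. -/
def rieszWeight (m r : ℕ) : ℝ := 1 / (4 * m * Real.sin (rieszNode m r / 2) ^ 2)

theorem rieszWeight_nonneg (m r : ℕ) : 0 ≤ rieszWeight m r := by
  unfold rieszWeight
  positivity

/-- The trigonometric moments `∑ᵣ aᵣ e ^ (i n tᵣ)` of the Riesz weights `aᵣ` at the nodes `tᵣ`. -/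
def rieszMoment (m n : ℕ) : ℂ :=
  ∑ r ∈ range (2 * m), rieszWeight m r * exp (I * rieszNode m r) ^ n

theorem exp_I_mul_sub_one_sq (t : ℂ) :
    (exp (I * t) - 1) ^ 2 = -(4 * sin (t / 2) ^ 2) * exp (I * t) := by
  have hcos : cos t = 2 * cos (t / 2) ^ 2 - 1 := by
    rw [← cos_two_mul, mul_div_cancel₀ _ two_ne_zero]
  rw [mul_comm I, exp_mul_I]
  linear_combination 2 * (cos t + sin t * I) * hcos - sin_sq_add_cos_sq t +
    4 * (cos t + sin t * I) * sin_sq_add_cos_sq (t / 2) + sin t ^ 2 * I_sq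

variable {m : ℕ} (hm : m ≠ 0)
include hm

theorem exp_rieszNode_pow_self (r : ℕ) : exp (I * rieszNode m r) ^ m = I * (-1) ^ r := by
  have hm' : (m : ℂ) ≠ 0 := by exact_mod_cast hm
  rw [← exp_nat_mul,
    show (m : ℂ) * (I * rieszNode m r) = π / 2 * I + r * (π * I) by
      simp only [rieszNode]; push_cast; field_simp; ring,
    exp_add, exp_pi_div_two_mul_I, exp_nat_mul, exp_pi_mul_I]

theorem exp_rieszNode_pow_two_mul (r : ℕ) : exp (I * rieszNode m r) ^ (2 * m) = -1 := by
  rw [mul_comm 2, pow_mul, exp_rieszNode_pow_self hm, mul_pow, I_sq, ← pow_mul, mul_comm r, pow_mul]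
  simp

theorem sum_exp_rieszNode_pow {n : ℕ} (hn : n ≠ 0) (hn' : n < 2 * m) :
    ∑ r ∈ range (2 * m), exp (I * rieszNode m r) ^ n = 0 := by
  have hζ := isPrimitiveRoot_exp (2 * m) (by lia)
  set ζ := exp (2 * π * I / ↑(2 * m)) with hζdef
  have hterm : ∀ r, exp (I * rieszNode m r) ^ n = exp (I * rieszNode m 0) ^ n * (ζ ^ n) ^ r := by
    intro r
    rw [hζdef, pow_right_comm, ← mul_pow, ← exp_nat_mul _ r, ← exp_add]
    congr 2
    simp only [rieszNode]
    push_cast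
    ring
  have hgeom : (∑ r ∈ range (2 * m), (ζ ^ n) ^ r) * (ζ ^ n - 1) = 0 := by
    rw [geom_sum_mul, pow_right_comm, hζ.pow_eq_one, one_pow, sub_self]
  rw [sum_congr rfl fun r _ => hterm r, ← mul_sum,
    (mul_eq_zero.1 hgeom).resolve_right (sub_ne_zero.2 (hζ.pow_ne_one_of_pos_of_lt hn hn')),
    mul_zero]

theorem sin_rieszNode_half_pos {r : ℕ} (hr : r < 2 * m) : 0 < Real.sin (rieszNode m r / 2) := by
  have hr' : (r : ℝ) + 1 ≤ 2 * m := by exact_mod_cast hr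
  apply Real.sin_pos_of_pos_of_lt_pi
  · unfold rieszNode
    positivity
  · rw [rieszNode, div_div, div_lt_iff₀ (by positivity)]
    nlinarith [Real.pi_pos]

theorem rieszWeight_mul_exp_sub_one_sq {r : ℕ} (hr : r < 2 * m) :
    rieszWeight m r * (exp (I * rieszNode m r) - 1) ^ 2 = -(1 / m) * exp (I * rieszNode m r) := by
  have hm' : (m : ℂ) ≠ 0 := by exact_mod_cast hm
  have hsin : sin (rieszNode m r / 2 : ℂ) ≠ 0 := by
    exact_mod_cast (sin_rieszNode_half_pos hm hr).ne'
  rw [exp_I_mul_sub_one_sq, rieszWeight]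
  push_cast
  field_simp

theorem rieszMoment_secondDiff (n : ℕ) :
    rieszMoment m (n + 2) - 2 * rieszMoment m (n + 1) + rieszMoment m n =
      -(1 / m) * ∑ r ∈ range (2 * m), exp (I * rieszNode m r) ^ (n + 1) := by
  simp only [rieszMoment, mul_sum, ← sum_sub_distrib, ← sum_add_distrib]
  refine sum_congr rfl fun r hr => ?_
  linear_combination
    exp (I * rieszNode m r) ^ n * rieszWeight_mul_exp_sub_one_sq hm (mem_range.1 hr)

theorem rieszMoment_add_two_mul (n : ℕ) : rieszMoment m (n + 2 * m) = -rieszMoment m n := by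
  simp only [rieszMoment, pow_add, exp_rieszNode_pow_two_mul hm, mul_neg, mul_one, sum_neg_distrib]

-- The second differences vanish below `2 m`, so the moments are affine there; the slope and the
-- initial value follow from the antiperiodicity and the second difference at the corner `2 m`.
theorem rieszMoment_eq_sub {n : ℕ} (hn : n ≤ 2 * m) : rieszMoment m n = m - n := by
  have hm' : (m : ℂ) ≠ 0 := by exact_mod_cast hm
  set g := rieszMoment m
  have haffine {n : ℕ} (hn : n ≤ 2 * m) : g n = g 0 + n * (g 1 - g 0) := by
    rw [← nsmul_eq_mul]
    refine eq_add_nsmul_of_secondDiff_eq_zero (fun n hn => ?_) hn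
    have h := rieszMoment_secondDiff hm n
    rw [sum_exp_rieszNode_pow hm (by lia) (by lia), mul_zero] at h
    linear_combination h
  have hcorner : g (2 * m + 1) - 2 * g (2 * m) + g (2 * m - 1) = 2 := by
    have h := rieszMoment_secondDiff hm (2 * m - 1)
    rw [show 2 * m - 1 + 2 = 2 * m + 1 by lia, show 2 * m - 1 + 1 = 2 * m by lia,
      sum_congr rfl fun r _ => exp_rieszNode_pow_two_mul hm r, sum_const, card_range,
      nsmul_eq_mul] at h
    rw [h]
    push_cast
    field_simp
  have hzero : g (2 * m) = -g 0 := by simpa only [zero_add] using rieszMoment_add_two_mul hm 0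
  have hone : g (2 * m + 1) = -g 1 := by simpa only [add_comm] using rieszMoment_add_two_mul hm 1
  have hend := haffine (le_refl (2 * m))
  have hpred := haffine (Nat.sub_le (2 * m) 1)
  rw [Nat.cast_sub (by lia)] at hpred
  push_cast at hend hpred
  have hslope : g 1 - g 0 = -1 := by
    linear_combination (hone - hcorner - hzero - hend + hpred) / 2
  rw [haffine hn, hslope]
  linear_combination (hzero - hend) / 2 - m * hslope

theorem sum_rieszWeight : ∑ r ∈ range (2 * m), rieszWeight m r = m := by
  have h := rieszMoment_eq_sub hm (Nat.zero_le (2 * m))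
  simp only [rieszMoment, pow_zero, mul_one, Nat.cast_zero, sub_zero] at h
  exact_mod_cast h

end Riesz

section Bernstein

open Complex Finset
open scoped Real

/-- The right-hand side of the interpolation formula of M. Riesz for the derivative of a
trigonometric polynomial of degree `m`. -/
def rieszDeriv (m : ℕ) (f : ℝ → ℂ) (t : ℝ) : ℂ :=
  ∑ r ∈ range (2 * m), ((-1) ^ r * rieszWeight m r : ℝ) * f (t + rieszNode m r)

/-- The space of complex trigonometric polynomials of degree at most `m` in one real variable. -/
def trigPoly (m : ℕ) : Submodule ℂ (ℝ → ℂ) :=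
  Submodule.span ℂ (Set.image (fun (k : ℤ) (t : ℝ) => exp (I * (k * t))) {k | |k| ≤ m})

theorem rieszDeriv_add (m : ℕ) (f g : ℝ → ℂ) (t : ℝ) :
    rieszDeriv m (f + g) t = rieszDeriv m f t + rieszDeriv m g t := by
  simp only [rieszDeriv, Pi.add_apply, mul_add, sum_add_distrib]

theorem rieszDeriv_smul (m : ℕ) (c : ℂ) (f : ℝ → ℂ) (t : ℝ) :
    rieszDeriv m (c • f) t = c • rieszDeriv m f t := by
  simp only [rieszDeriv, Pi.smul_apply, smul_eq_mul, mul_left_comm, mul_sum]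

theorem norm_rieszDeriv_le {m : ℕ} (hm : m ≠ 0) {f : ℝ → ℂ} {M : ℝ} (hf : ∀ t, ‖f t‖ ≤ M)
    (t : ℝ) : ‖rieszDeriv m f t‖ ≤ m * M := by
  rw [← sum_rieszWeight hm, sum_mul]
  refine (norm_sum_le _ _).trans (sum_le_sum fun r _ => ?_)
  rw [norm_mul, norm_real, norm_mul, norm_pow, norm_neg, norm_one, one_pow, one_mul,
    Real.norm_of_nonneg (rieszWeight_nonneg m r)]
  exact mul_le_mul_of_nonneg_left (hf _) (rieszWeight_nonneg m r)

theorem rieszDeriv_exp {m : ℕ} (hm : m ≠ 0) {k : ℤ} (hk : |k| ≤ m) (t : ℝ) :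
    rieszDeriv m (fun t => exp (I * (k * t))) t = I * k * exp (I * (k * t)) := by
  obtain ⟨n, hn⟩ : ∃ n : ℕ, (n : ℤ) = m + k := ⟨(m + k).toNat, by grind⟩
  have hn' : (n : ℂ) = m + k := by exact_mod_cast hn
  have hshift (r : ℕ) : (-1) ^ r * exp (I * (k * rieszNode m r)) =
      -I * exp (I * rieszNode m r) ^ n := by
    have hpow : exp (I * rieszNode m r) ^ n =
        I * (-1) ^ r * exp (I * (k * rieszNode m r)) := by
      rw [← exp_rieszNode_pow_self hm, ← exp_nat_mul, ← exp_nat_mul, ← exp_add]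
      rw [hn']
      congr 1
      ring
    rw [hpow]
    linear_combination (-1) ^ r * exp (I * (k * rieszNode m r)) * I_sq
  have hterm (r : ℕ) : ((-1) ^ r * rieszWeight m r : ℝ) * exp (I * (k * ↑(t + rieszNode m r))) =
      -I * exp (I * (k * t)) * (rieszWeight m r * exp (I * rieszNode m r) ^ n) := by
    push_cast
    rw [mul_add, mul_add, exp_add]
    linear_combination rieszWeight m r * exp (I * (k * t)) * hshift r
  rw [rieszDeriv, sum_congr rfl fun r _ => hterm r, ← mul_sum, ← rieszMoment,
    rieszMoment_eq_sub hm (by grind), hn']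
  ring

theorem hasDerivAt_of_mem_trigPoly {m : ℕ} (hm : m ≠ 0) {f : ℝ → ℂ} (hf : f ∈ trigPoly m)
    (t : ℝ) : HasDerivAt f (rieszDeriv m f t) t := by
  induction hf using Submodule.span_induction with
  | mem f hf =>
    obtain ⟨k, hk, rfl⟩ := hf
    rw [rieszDeriv_exp hm hk, mul_comm]
    have h := ((hasDerivAt_id t).ofReal_comp.const_mul (I * k)).cexp
    simpa only [id_eq, ofReal_one, mul_one, mul_assoc] using h
  | zero => simp [rieszDeriv]
  | add f g _ _ hf hg => exact rieszDeriv_add m f g t ▸ hf.add hg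
  | smul c f _ hf => exact rieszDeriv_smul m c f t ▸ hf.const_smul c

theorem hasDerivAt_rieszDeriv {m : ℕ} {f : ℝ → ℂ} (hf : ∀ t, HasDerivAt f (rieszDeriv m f t) t)
    (t : ℝ) : HasDerivAt (rieszDeriv m f) (rieszDeriv m (rieszDeriv m f) t) t :=
  HasDerivAt.fun_sum fun _ _ => ((hf _).comp_add_const t _).const_mul _

theorem norm_sub_le_of_hasDerivAt_rieszDeriv {m : ℕ} (hm : m ≠ 0) {f : ℝ → ℂ} {M : ℝ}
    (hf : ∀ t, HasDerivAt f (rieszDeriv m f t) t) (hM : ∀ t, ‖f t‖ ≤ M) (t s : ℝ) :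
    ‖f t - f s‖ ≤ m * M * |t - s| :=
  Convex.norm_image_sub_le_of_norm_hasDerivWithin_le (fun x _ => (hf x).hasDerivWithinAt)
    (fun x _ => norm_rieszDeriv_le hm hM x) convex_univ (Set.mem_univ s) (Set.mem_univ t)

theorem sub_le_mul_sq_of_isLocalMax {g g' : ℝ → ℝ} {s K : ℝ} (hg : ∀ t, HasDerivAt g (g' t) t)
    (hs : IsLocalMax g s) (hK : ∀ t, |g' t - g' s| ≤ K * |t - s|) (t : ℝ) :
    g s - g t ≤ K * |t - s| ^ 2 := by
  have hcrit : g' s = 0 := hs.hasDerivAt_eq_zero (hg s)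
  have hK0 : 0 ≤ K := by simpa using (abs_nonneg _).trans (hK (s + 1))
  have hbound : ∀ z ∈ Set.uIcc s t, ‖g' z‖ ≤ K * |t - s| := fun z hz => by
    have h := hK z
    rw [hcrit, sub_zero] at h
    exact h.trans (mul_le_mul_of_nonneg_left (Set.abs_sub_left_of_mem_uIcc hz) hK0)
  have h := Convex.norm_image_sub_le_of_norm_hasDerivWithin_le
    (fun x _ => (hg x).hasDerivWithinAt) hbound (convex_uIcc s t) Set.right_mem_uIcc
    Set.left_mem_uIcc
  rw [Real.norm_eq_abs, Real.norm_eq_abs, abs_sub_comm s t, mul_assoc, ← sq] at h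
  exact (le_abs_self _).trans h

theorem one_sub_sq_le_norm_of_mem_trigPoly {m : ℕ} (hm : m ≠ 0) {f : ℝ → ℂ} (hf : f ∈ trigPoly m)
    (hle : ∀ t, ‖f t‖ ≤ 1) {s : ℝ} (hs : ‖f s‖ = 1) (t : ℝ) :
    1 - (m * |t - s|) ^ 2 ≤ ‖f t‖ := by
  have hderiv := hasDerivAt_of_mem_trigPoly hm hf
  set u : ℂ := (starRingEnd ℂ) (f s)
  have hu (z : ℂ) : (u * z).re ≤ ‖z‖ := (re_le_norm _).trans (by simp [u, hs])
  have hus : (u * f s).re = 1 := by simp [u, mul_comm, mul_conj', hs]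
  have hlip (t : ℝ) :
      |(u * rieszDeriv m f t).re - (u * rieszDeriv m f s).re| ≤ m ^ 2 * |t - s| := by
    rw [← sub_re, ← mul_sub]
    refine (abs_re_le_norm _).trans ?_
    rw [norm_mul, RCLike.norm_conj, hs, one_mul, sq, ← mul_one (m * m : ℝ), mul_assoc (m : ℝ)]
    exact norm_sub_le_of_hasDerivAt_rieszDeriv hm (hasDerivAt_rieszDeriv hderiv)
      (norm_rieszDeriv_le hm hle) t s
  have h := sub_le_mul_sq_of_isLocalMax
    (fun t => reCLM.hasFDerivAt.comp_hasDerivAt t ((hderiv t).const_mul u))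
    (.of_forall fun t => by simpa [hus] using (hu (f t)).trans (hle t)) hlip t
  simp only [Function.comp_apply, reCLM_apply, hus] at h
  rw [mul_pow]
  linarith [hu (f t)]

end Bernstein

section PenalizedLeastSquares

open Filter Topology
open scoped RealInnerProductSpace

variable {M H : Type*} [AddCommGroup M] [Module ℝ M] [NormedAddCommGroup H]
  [InnerProductSpace ℝ H]

/-- `μ` minimizes the penalized least squares functional `½ ‖A μ - y‖² + lam N μ`. -/
def IsPenalizedMin (A : M →ₗ[ℝ] H) (N : M → ℝ) (y : H) (lam : ℝ) (μ : M) : Prop :=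
  ∀ ν, 1 / 2 * ‖A μ - y‖ ^ 2 + lam * N μ ≤ 1 / 2 * ‖A ν - y‖ ^ 2 + lam * N ν

variable {A : M →ₗ[ℝ] H} {N : M → ℝ} {y : H} {lam : ℝ} {μ : M}

theorem IsPenalizedMin.mul_sub_le_inner (h : IsPenalizedMin A N y lam μ)
    (hN : ConvexOn ℝ Set.univ N) (hlam : 0 ≤ lam) (ν : M) :
    lam * (N μ - N ν) ≤ ⟪A μ - y, A ν - A μ⟫ := by
  have hstep : ∀ t ∈ Set.Ioo (0 : ℝ) 1,
      lam * (N μ - N ν) - ⟪A μ - y, A ν - A μ⟫ ≤ t / 2 * ‖A ν - A μ‖ ^ 2 := by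
    rintro t ⟨ht0, ht1⟩
    have hmin := h ((1 - t) • μ + t • ν)
    have hconv := mul_le_mul_of_nonneg_left (hN.2 (Set.mem_univ μ) (Set.mem_univ ν)
      (sub_nonneg.2 ht1.le) ht0.le (sub_add_cancel 1 t)) hlam
    have hsq : ‖A ((1 - t) • μ + t • ν) - y‖ ^ 2 = ‖A μ - y‖ ^ 2 +
        2 * (t * ⟪A μ - y, A ν - A μ⟫) + t ^ 2 * ‖A ν - A μ‖ ^ 2 := by
      have harg : A ((1 - t) • μ + t • ν) - y = (A μ - y) + t • (A ν - A μ) := by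
        simp only [map_add, map_smul]
        module
      rw [harg, norm_add_sq_real, inner_smul_right, norm_smul, mul_pow, Real.norm_eq_abs, sq_abs]
    rw [hsq] at hmin
    simp only [smul_eq_mul] at hconv
    refine le_of_mul_le_mul_left ?_ ht0
    linear_combination hmin + hconv
  have hlim : Tendsto (fun t : ℝ => t / 2 * ‖A ν - A μ‖ ^ 2) (𝓝[>] 0) (𝓝 0) :=
    tendsto_nhdsWithin_of_tendsto_nhds <| Continuous.tendsto' (by fun_prop) _ _ (by simp)
  exact sub_nonpos.1 <| ge_of_tendsto hlim <|
    eventually_of_mem (Ioo_mem_nhdsGT one_pos) hstep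

theorem IsPenalizedMin.mul_sub_le (h : IsPenalizedMin A N y lam μ) (hN : ConvexOn ℝ Set.univ N)
    {ν : M} (hν : ‖A ν - y‖ ≤ lam) :
    lam * (N μ - N ν) ≤ lam * ‖A μ - A ν‖ - ‖A μ - A ν‖ ^ 2 := by
  refine (h.mul_sub_le_inner hN ((norm_nonneg _).trans hν) ν).trans ?_
  have hsplit : ⟪A μ - y, A ν - A μ⟫ = ⟪A ν - y, A ν - A μ⟫ - ‖A ν - A μ‖ ^ 2 := by
    rw [← real_inner_self_eq_norm_sq, ← inner_sub_left, sub_sub_sub_cancel_left]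
  rw [hsplit, norm_sub_rev (A μ)]
  gcongr
  exact (real_inner_le_norm _ _).trans (by gcongr)

theorem IsPenalizedMin.sub_le (h : IsPenalizedMin A N y lam μ) (hN : ConvexOn ℝ Set.univ N)
    (hlam : 0 < lam) {ν : M} (hν : ‖A ν - y‖ ≤ lam) {b : ℝ} (hb : N ν - b ≤ ‖A μ - A ν‖) :
    N μ - b ≤ lam := by
  refine le_of_mul_le_mul_left ?_ hlam
  linear_combination h.mul_sub_le hN hν + lam * hb + sq_nonneg (‖A μ - A ν‖ - lam)

theorem IsPenalizedMin.norm_sub_le (h : IsPenalizedMin A N y lam μ) (hN : ConvexOn ℝ Set.univ N)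
    (hlam : 0 ≤ lam) {ν : M} (hν : ‖A ν - y‖ ≤ lam) {b : ℝ} (hb : N ν - b ≤ ‖A μ - A ν‖)
    (hbμ : b ≤ N μ) : ‖A μ - A ν‖ ≤ 2 * lam := by
  rcases (norm_nonneg (A μ - A ν)).eq_or_lt with h0 | hpos
  · rw [← h0]
    positivity
  · refine le_of_mul_le_mul_left ?_ hpos
    linear_combination h.mul_sub_le hN hν + lam * hb + lam * hbμ

end PenalizedLeastSquares

section ComplexMeasures

variable {X : Type*} [MeasurableSpace X]

instance isFiniteMeasure_variation (μ : ComplexMeasure X) : IsFiniteMeasure μ.variation := by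
  refine isFiniteMeasure_of_le
    ((ComplexMeasure.re μ).totalVariation + (ComplexMeasure.im μ).totalVariation)
    (VectorMeasure.variation_le_of_forall_enorm_le fun s _ => ?_)
  calc ‖μ s‖ₑ ≤ ‖(μ s).re‖ₑ + ‖(μ s).im‖ₑ := by
        simp only [← ofReal_norm, ← ENNReal.ofReal_add (norm_nonneg _) (norm_nonneg _)]
        exact ENNReal.ofReal_le_ofReal (Complex.norm_le_abs_re_add_abs_im (μ s))
    _ ≤ _ := add_le_add (SignedMeasure.enorm_le_totalVariation (ComplexMeasure.re μ) s)
        (SignedMeasure.enorm_le_totalVariation (ComplexMeasure.im μ) s)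

/-- The integral of a complex-valued function against a complex measure. -/
def cintegral (μ : ComplexMeasure X) (f : X → ℂ) : ℂ :=
  μ.integral f (ContinuousLinearMap.mul ℝ ℂ)

theorem norm_cintegral_le (μ : ComplexMeasure X) (f : X → ℂ) :
    ‖cintegral μ f‖ ≤ ∫ x, ‖f x‖ ∂μ.variation :=
  VectorMeasure.norm_integral_le_integral_norm.trans <|
    mul_le_of_le_one_left (integral_nonneg fun _ => norm_nonneg _)
      (ContinuousLinearMap.opNorm_mul_le ℝ ℂ)

theorem mul_integral_lsmul (μ : ComplexMeasure X) (c : ℂ) {f : X → ℝ}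
    (hf : Integrable f μ.variation) :
    c * μ.integral f (ContinuousLinearMap.lsmul ℝ ℝ) = cintegral μ fun x => c * f x := by
  have hout := VectorMeasure.continuousLinearMap_apply_integral
    (B := ContinuousLinearMap.lsmul ℝ ℝ) (C := ContinuousLinearMap.mul ℝ ℂ c) hf
  have hin := VectorMeasure.integral_continuousLinearMap_comp (B := ContinuousLinearMap.mul ℝ ℂ)
    (C := (ContinuousLinearMap.mul ℝ ℂ c).comp Complex.ofRealCLM) hf
  simp only [ContinuousLinearMap.mul_apply', ContinuousLinearMap.comp_apply,
    Complex.ofRealCLM_apply] at hout hin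
  rw [hout, cintegral, hin]
  congr 1
  ext
  simp

end ComplexMeasures

section Moments

theorem integrable_of_continuous {X E : Type*} [TopologicalSpace X] [CompactSpace X]
    [MeasurableSpace X] [OpensMeasurableSpace X] [NormedAddCommGroup E]
    [SecondCountableTopologyEither X E] {ν : Measure X} [IsFiniteMeasureOnCompacts ν] {f : X → E}
    (hf : Continuous f) : Integrable f ν :=
  hf.integrable_of_hasCompactSupport (HasCompactSupport.of_compactSpace f)

@[fun_prop]
theorem continuous_cheb (k : ℕ) : Continuous (cheb k) := by
  unfold cheb
  split_ifs <;> fun_prop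

theorem moment_add (k : ℕ) (μ ν : ComplexMeasure Dom) :
    moment k (μ + ν) = moment k μ + moment k ν :=
  VectorMeasure.integral_add_vectorMeasure (integrable_of_continuous (continuous_cheb k))
    (integrable_of_continuous (continuous_cheb k))

theorem moment_smul (k : ℕ) (c : ℝ) (μ : ComplexMeasure Dom) :
    moment k (c • μ) = c • moment k μ :=
  VectorMeasure.integral_smul_vectorMeasure (cheb k) c

/-- The map sending a complex measure to its first `m + 1` generalized moments, as a linear map
into the Euclidean space in which the data fidelity of `objective` is measured. -/
def momentVec (m : ℕ) : ComplexMeasure Dom →ₗ[ℝ] EuclideanSpace ℂ (Fin (m + 1)) where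
  toFun μ := WithLp.toLp 2 fun k => moment k μ
  map_add' μ ν := by
    ext k
    exact moment_add k μ ν
  map_smul' c μ := by
    ext k
    exact moment_smul k c μ

/-- The total variation norm as a seminorm on the real vector space of complex measures. -/
def tvSeminorm : Seminorm ℝ (ComplexMeasure Dom) :=
  Seminorm.of tvNorm
    (fun μ ν => by
      unfold tvNorm
      rw [← measureReal_add_apply]
      exact ENNReal.toReal_mono (measure_ne_top _ _) (VectorMeasure.variation_add_le _))
    (fun c μ => by
      unfold tvNorm
      rw [VectorMeasure.variation_smul, measureReal_nnreal_smul_apply]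
      simp)

theorem IsSolution.isPenalizedMin {m : ℕ} {lam : ℝ} {y : Fin (m + 1) → ℂ}
    {μ : ComplexMeasure Dom} (h : IsSolution m lam y μ) :
    IsPenalizedMin (momentVec m) tvSeminorm (WithLp.toLp 2 y) lam μ := by
  intro ν
  simp only [EuclideanSpace.norm_sq_eq]
  exact h ν

theorem continuous_of_mem_chebSpan {m : ℕ} {P : Dom → ℂ} (hP : P ∈ chebSpan m) :
    Continuous P := by
  obtain ⟨α, rfl⟩ := (Submodule.mem_span_range_iff_exists_fun ℂ).1 hP
  rw [Finset.sum_fn]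
  fun_prop

theorem cintegral_sum_smul_cheb {m : ℕ} (μ : ComplexMeasure Dom) (α : Fin (m + 1) → ℂ) :
    cintegral μ (∑ k, α k • fun x => (cheb k x : ℂ)) = ∑ k, α k * momentVec m μ k := by
  rw [cintegral, Finset.sum_fn,
    VectorMeasure.integral_finsetSum _ fun k _ => integrable_of_continuous (by fun_prop)]
  exact Finset.sum_congr rfl fun k _ =>
    (mul_integral_lsmul μ (α k) (integrable_of_continuous (continuous_cheb k))).symm

theorem cintegral_sub_of_mem_chebSpan {m : ℕ} {P : Dom → ℂ} (hP : P ∈ chebSpan m)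
    (μ ν : ComplexMeasure Dom) : cintegral (μ - ν) P = cintegral μ P - cintegral ν P := by
  obtain ⟨α, rfl⟩ := (Submodule.mem_span_range_iff_exists_fun ℂ).1 hP
  simp only [cintegral_sum_smul_cheb, map_sub, PiLp.sub_apply, mul_sub, Finset.sum_sub_distrib]

end Moments

section Spikes

variable {s : ℕ} (T : Fin s → Dom) {a : Fin s → ℝ} (θ : Fin s → ℝ)

theorem cintegral_spikes {P : Dom → ℂ} (hP : Continuous P) (a : Fin s → ℝ) :
    cintegral (spikes T a θ) P =
      ∑ j, P (T j) * (a j * Complex.exp (Complex.I * (θ j : ℂ))) := by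
  unfold cintegral spikes
  rw [VectorMeasure.integral_finsetSum_vectorMeasure fun _ _ => integrable_of_continuous hP]
  simp [VectorMeasure.integral_dirac]

theorem tvNorm_spikes_le (ha : ∀ j, 0 ≤ a j) : tvNorm (spikes T a θ) ≤ ∑ j, a j := by
  refine (Finset.le_sum_of_subadditive tvSeminorm (map_zero _).le (map_add_le_add _) _ _).trans
    (Finset.sum_le_sum fun j _ => le_of_eq ?_)
  change tvNorm _ = a j
  rw [tvNorm, VectorMeasure.variation_dirac]
  simp [mul_comm Complex.I, abs_of_nonneg (ha j)]

end Spikes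

section Bessel

theorem integral_norm_sq_sum_of_orthogonal {X ι : Type*} [MeasurableSpace X] {ν : Measure X}
    [Fintype ι] [DecidableEq ι] {φ : ι → X → ℝ} {c : ℝ}
    (hint : ∀ k l, Integrable (fun x => φ k x * φ l x) ν)
    (horth : ∀ k l, ∫ x, φ k x * φ l x ∂ν = if k = l then c else 0) (α : ι → ℂ) :
    ∫ x, ‖∑ k, α k * φ k x‖ ^ 2 ∂ν = c * ∑ k, ‖α k‖ ^ 2 := by
  have hexpand (x : X) : ‖∑ k, α k * (φ k x : ℂ)‖ ^ 2 =
      ∑ k, ∑ l, (α k * (starRingEnd ℂ) (α l)).re * (φ k x * φ l x) := by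
    rw [← Complex.ofReal_re (_ ^ 2), Complex.ofReal_pow, ← Complex.mul_conj', map_sum,
      Finset.sum_mul_sum]
    simp only [Complex.re_sum, map_mul, Complex.conj_ofReal]
    refine Finset.sum_congr rfl fun k _ => Finset.sum_congr rfl fun l _ => ?_
    rw [mul_mul_mul_comm, ← Complex.ofReal_mul, Complex.re_mul_ofReal]
  simp_rw [hexpand]
  rw [integral_finsetSum _ fun k _ => integrable_finsetSum _ fun l _ => (hint k l).const_mul _]
  simp_rw [integral_finsetSum _ fun l _ => (hint _ l).const_mul _, integral_const_mul, horth]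
  simp only [mul_ite, mul_zero, Finset.sum_ite_eq, Finset.mem_univ, if_true, ← Finset.sum_mul]
  simp_rw [Complex.mul_conj', ← Complex.ofReal_pow, Complex.ofReal_re, mul_comm]

/-- The normalization of the `k`-th Chebyshev polynomial in `cheb`. -/
def chebScale (k : ℕ) : ℝ := if k = 0 then 1 else Real.sqrt 2

theorem cheb_eq_chebScale_mul (k : ℕ) (x : Dom) :
    cheb k x = chebScale k * (Polynomial.Chebyshev.T ℝ k).eval (x : ℝ) := by
  unfold cheb chebScale
  split_ifs with hk <;> simp [hk]

open Polynomial.Chebyshev in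
theorem integral_chebScale_mul_T_mul (k l : ℕ) :
    ∫ x, chebScale k * (T ℝ k).eval x * (chebScale l * (T ℝ l).eval x) ∂measureT =
      if k = l then Real.pi else 0 := by
  simp_rw [mul_mul_mul_comm (chebScale k)]
  rw [integral_const_mul]
  split_ifs with h
  · subst h
    by_cases hk : k = 0
    · subst hk
      simpa [chebScale] using integral_eval_T_real_mul_self_measureT_zero
    · rw [integral_T_real_mul_self_measureT_of_ne_zero hk, chebScale, if_neg hk,
        Real.mul_self_sqrt zero_le_two, mul_div_cancel₀ _ two_ne_zero]
  · rw [integral_eval_T_real_mul_eval_T_real_measureT_of_ne h, mul_zero]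

open Polynomial.Chebyshev in
theorem sqrt_sum_norm_sq_le_of_norm_sum_cheb_le {m : ℕ} {α : Fin (m + 1) → ℂ} {M : ℝ} (hM0 : 0 ≤ M)
    (hM : ∀ x, ‖∑ k, α k * (cheb k x : ℂ)‖ ≤ M) : √(∑ k, ‖α k‖ ^ 2) ≤ M := by
  have hparseval := integral_norm_sq_sum_of_orthogonal (ν := measureT) (c := Real.pi)
    (φ := fun (k : Fin (m + 1)) x => chebScale k * (T ℝ (k : ℕ)).eval x)
    (fun k l => integrable_measureT (by fun_prop))
    (fun k l => by simp only [integral_chebScale_mul_T_mul, Fin.val_inj]) α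
  have hmass : ∫ _, M ^ 2 ∂measureT = Real.pi * M ^ 2 := by
    have h : ∫ _, (1 : ℝ) ∂measureT = Real.pi := by simpa using integral_eval_T_real_measureT_zero
    rw [← h, ← integral_mul_const]
    simp only [one_mul]
  have hmem : ∀ᵐ x ∂measureT, x ∈ Set.Ioc (-1 : ℝ) 1 := by
    unfold measureT
    exact ae_restrict_mem measurableSet_Ioc
  have hle : Real.pi * ∑ k, ‖α k‖ ^ 2 ≤ Real.pi * M ^ 2 := by
    rw [← hparseval, ← hmass]
    refine integral_mono_ae (integrable_measureT (by fun_prop)) (integrable_measureT (by fun_prop))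
      ?_
    filter_upwards [hmem] with x hx
    have h := hM ⟨x, hx.1.le, hx.2⟩
    simp only [cheb_eq_chebScale_mul] at h
    gcongr
  exact Real.sqrt_le_iff.2 ⟨hM0, le_of_mul_le_mul_left hle Real.pi_pos⟩

theorem norm_cintegral_le_mul_norm_momentVec {m : ℕ} {P : Dom → ℂ} (hP : P ∈ chebSpan m) {M : ℝ}
    (hM : ∀ x, ‖P x‖ ≤ M) (μ : ComplexMeasure Dom) :
    ‖cintegral μ P‖ ≤ M * ‖momentVec m μ‖ := by
  obtain ⟨α, rfl⟩ := (Submodule.mem_span_range_iff_exists_fun ℂ).1 hP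
  have hM0 : 0 ≤ M := (norm_nonneg _).trans (hM ⟨0, by norm_num⟩)
  rw [cintegral_sum_smul_cheb]
  calc ‖∑ k, α k * momentVec m μ k‖ ≤ ∑ k, ‖α k‖ * ‖momentVec m μ k‖ :=
        norm_sum_le_of_le _ fun k _ => norm_mul_le _ _
    _ ≤ √(∑ k, ‖α k‖ ^ 2) * ‖momentVec m μ‖ := by
        rw [EuclideanSpace.norm_eq]
        exact Real.sum_mul_le_sqrt_mul_sqrt _ _ _
    _ ≤ M * ‖momentVec m μ‖ := by
        gcongr
        refine sqrt_sum_norm_sq_le_of_norm_sum_cheb_le hM0 fun x => ?_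
        simpa using hM x

end Bessel

section ChebyshevBernstein

open Complex

/-- The substitution `x = cos t` turning polynomials on `[-1, 1]` into trigonometric ones. -/
def cosDom (t : ℝ) : Dom := ⟨Real.cos t, Real.neg_one_le_cos t, Real.cos_le_one t⟩

theorem cosDom_arccos (x : Dom) : cosDom (Real.arccos x) = x :=
  Subtype.ext (Real.cos_arccos x.2.1 x.2.2)

theorem comp_cosDom_mem_trigPoly {m : ℕ} {P : Dom → ℂ} (hP : P ∈ chebSpan m) :
    P ∘ cosDom ∈ trigPoly m := by
  suffices h : chebSpan m ≤ (trigPoly m).comap (LinearMap.funLeft ℂ ℂ cosDom) from h hP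
  rw [chebSpan, Submodule.span_le]
  rintro _ ⟨k, rfl⟩
  have hexp {l : ℤ} (hl : |l| ≤ m) : (fun t : ℝ => exp (I * (l * t))) ∈ trigPoly m :=
    Submodule.subset_span ⟨l, hl, rfl⟩
  have hcos : (fun t => (cheb k (cosDom t) : ℂ)) = ((chebScale k / 2 : ℝ) : ℂ) •
      ((fun t : ℝ => exp (I * (((k : ℕ) : ℤ) * t))) +
        fun t : ℝ => exp (I * ((-(k : ℕ) : ℤ) * t))) := by
    ext t
    rw [cheb_eq_chebScale_mul, cosDom, Polynomial.Chebyshev.T_real_cos]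
    push_cast
    simp only [Complex.cos, Pi.smul_apply, Pi.add_apply, smul_eq_mul]
    ring_nf
  change (fun t => (cheb k (cosDom t) : ℂ)) ∈ trigPoly m
  rw [hcos]
  exact Submodule.smul_mem _ _ (add_mem (hexp (by rw [Nat.abs_cast]; lia))
    (hexp (by rw [abs_neg, Nat.abs_cast]; lia)))

variable {m : ℕ} (hm : m ≠ 0) {P : Dom → ℂ} (hP : P ∈ chebSpan m) (hle : ∀ x, ‖P x‖ ≤ 1)
include hm hP hle

theorem norm_sub_le_mul_abs_arccos_sub (x y : Dom) :
    ‖P x - P y‖ ≤ m * |Real.arccos x - Real.arccos y| := by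
  have h := norm_sub_le_of_hasDerivAt_rieszDeriv hm
    (hasDerivAt_of_mem_trigPoly hm (comp_cosDom_mem_trigPoly hP)) (fun t => hle (cosDom t))
    (Real.arccos x) (Real.arccos y)
  simpa only [Function.comp_apply, cosDom_arccos, mul_one] using h

theorem one_sub_sq_le_norm_of_mem_chebSpan {y : Dom} (hy : ‖P y‖ = 1) (x : Dom) :
    1 - (m * |Real.arccos x - Real.arccos y|) ^ 2 ≤ ‖P x‖ := by
  have h := one_sub_sq_le_norm_of_mem_trigPoly hm (comp_cosDom_mem_trigPoly hP)
    (fun t => hle (cosDom t)) (s := Real.arccos y) (by rwa [Function.comp_apply, cosDom_arccos])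
    (Real.arccos x)
  rwa [Function.comp_apply, cosDom_arccos] at h

end ChebyshevBernstein

theorem abs_arccos_sub_le {b x y : ℝ} (hb : b < 1) (hx : |x| ≤ b) (hy : |y| ≤ b) :
    |Real.arccos x - Real.arccos y| ≤ |x - y| / √(1 - b ^ 2) := by
  have hpos : 0 < 1 - b ^ 2 := by nlinarith [(abs_nonneg x).trans hx]
  have hbound : ∀ z ∈ Set.Icc (-b) b, ‖-(1 / √(1 - z ^ 2))‖ ≤ 1 / √(1 - b ^ 2) := by
    intro z hz
    rw [norm_neg, Real.norm_of_nonneg (by positivity)]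
    exact one_div_le_one_div_of_le (Real.sqrt_pos.2 hpos)
      (Real.sqrt_le_sqrt (sub_le_sub_left (sq_le_sq' hz.1 hz.2) 1))
  have h := Convex.norm_image_sub_le_of_norm_hasDerivWithin_le
    (fun z hz => (Real.hasDerivAt_arccos (by linarith [hz.1])
      (by linarith [hz.2])).hasDerivWithinAt) hbound (convex_Icc _ _) (abs_le.1 hy) (abs_le.1 hx)
  rwa [Real.norm_eq_abs, Real.norm_eq_abs, one_div_mul_eq_div] at h

section Duality

variable {P : Dom → ℂ} (hP : Continuous P) (μ : ComplexMeasure Dom)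
include hP

theorem integral_one_sub_norm_le_sub_re_cintegral :
    ∫ x, (1 - ‖P x‖) ∂μ.variation ≤ tvNorm μ - (cintegral μ P).re := by
  rw [integral_sub (integrable_const _) (integrable_of_continuous hP).norm]
  have hmass : ∫ _, (1 : ℝ) ∂μ.variation = tvNorm μ := by simp [tvNorm]
  rw [hmass]
  exact sub_le_sub_left ((Complex.re_le_norm _).trans (norm_cintegral_le μ P)) _

theorem norm_singleton_mul_le_sub_re_cintegral (hle : ∀ x, ‖P x‖ ≤ 1) (x : Dom) :
    ‖μ {x}‖ * (1 - ‖P x‖) ≤ tvNorm μ - (cintegral μ P).re :=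
  calc ‖μ {x}‖ * (1 - ‖P x‖) ≤ μ.variation.real {x} * (1 - ‖P x‖) :=
        mul_le_mul_of_nonneg_right VectorMeasure.norm_measure_le_variation (sub_nonneg.2 (hle x))
    _ = ∫ y in {x}, (1 - ‖P y‖) ∂μ.variation := by rw [integral_singleton, smul_eq_mul]
    _ ≤ ∫ y, (1 - ‖P y‖) ∂μ.variation :=
        setIntegral_le_integral (integrable_of_continuous (by fun_prop))
          (.of_forall fun y => sub_nonneg.2 (hle y))
    _ ≤ _ := integral_one_sub_norm_le_sub_re_cintegral hP μ

theorem re_cintegral_le_mul_tvNorm {L : ℝ} (hL : ∀ x ∈ supp μ, ‖P x‖ ≤ L) :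
    (cintegral μ P).re ≤ L * tvNorm μ :=
  calc (cintegral μ P).re ≤ ∫ x, ‖P x‖ ∂μ.variation :=
        (Complex.re_le_norm _).trans (norm_cintegral_le μ P)
    _ ≤ ∫ _, L ∂μ.variation := by
        refine integral_mono_ae (integrable_of_continuous hP).norm (integrable_const _) ?_
        filter_upwards [Measure.support_mem_ae (μ := μ.variation)] with x hx using hL x hx
    _ = L * tvNorm μ := by simp [tvNorm, mul_comm]

end Duality

/-- `P` is a dual certificate for the phases `θ` at the points `T`: a generalized polynomial of
modulus at most `1` which interpolates the conjugate phases, and whose modulus stays below `1` by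
`min {Ca m² |x - t|², Cb}`, where `t` is the point of `T` nearest to `x`. The minimum over the
points is expressed through its lower bounds `g`. -/
structure IsDualCertificate (m : ℕ) {s : ℕ} (T : Fin s → Dom) (Ca Cb : ℝ) (θ : Fin s → ℝ)
    (P : Dom → ℂ) : Prop where
  mem_chebSpan : P ∈ chebSpan m
  norm_le_one : ∀ x, ‖P x‖ ≤ 1
  interpolates : ∀ k, P (T k) = Complex.exp (-(Complex.I * (θ k : ℂ)))
  isolates : ∀ (x : Dom) (g : ℝ), g ≤ Cb →
    (∀ k, g ≤ Ca * (m : ℝ) ^ 2 * |(x : ℝ) - T k| ^ 2) → ‖P x‖ ≤ 1 - g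

section DualCertificate

variable {m s : ℕ} {T : Fin s → Dom} {Ca Cb c₀ : ℝ} {θ : Fin s → ℝ} {P : Dom → ℂ}

theorem QIC.exists_isDualCertificate (h : QIC m T Ca Cb) (θ : Fin s → ℝ) :
    ∃ P, IsDualCertificate m T Ca Cb θ P := by
  obtain ⟨hCa, hCb, hCb1, hex⟩ := h
  rcases isEmpty_or_nonempty (Fin s) with hs | hs
  · exact ⟨0, zero_mem _, by simp, isEmptyElim, fun x g hg _ => by
      simpa using hg.trans hCb1.le⟩
  · obtain ⟨P, hP, hinterp, hiso⟩ := hex θ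
    have hgap (x : Dom) (g : ℝ) (hg : g ≤ Cb)
        (hgk : ∀ k, g ≤ Ca * (m : ℝ) ^ 2 * |(x : ℝ) - T k| ^ 2) : ‖P x‖ ≤ 1 - g :=
      le_sub_comm.1 ((le_ciInf fun k => le_min (hgk k) hg).trans (hiso x))
    refine ⟨P, hP, fun x => ?_, hinterp, hgap⟩
    simpa using hgap x 0 hCb.le fun k => by positivity

namespace IsDualCertificate

theorem norm_apply_eq_one (h : IsDualCertificate m T Ca Cb θ P) (k : Fin s) :
    ‖P (T k)‖ = 1 := by
  rw [h.interpolates, mul_comm, ← neg_mul, ← Complex.ofReal_neg, Complex.norm_exp_ofReal_mul_I]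

theorem cintegral_spikes (h : IsDualCertificate m T Ca Cb θ P) (a : Fin s → ℝ) :
    cintegral (spikes T a θ) P = (∑ j, a j : ℝ) := by
  rw [MomentBlasso.cintegral_spikes T θ (continuous_of_mem_chebSpan h.mem_chebSpan),
    Complex.ofReal_sum]
  refine Finset.sum_congr rfl fun j _ => ?_
  rw [h.interpolates, mul_left_comm, ← Complex.exp_add, neg_add_cancel, Complex.exp_zero, mul_one]

theorem cintegral_spikes_flip [DecidableEq (Fin s)] {j : Fin s}
    (h : IsDualCertificate m T Ca Cb (Function.update θ j (θ j + Real.pi)) P) (a : Fin s → ℝ) :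
    cintegral (spikes T a θ) P = (∑ i, a i - 2 * a j : ℝ) := by
  have hspikes : cintegral (spikes T a θ) P =
      cintegral (spikes T (Function.update a j (-a j))
        (Function.update θ j (θ j + Real.pi))) P := by
    simp only [MomentBlasso.cintegral_spikes T _ (continuous_of_mem_chebSpan h.mem_chebSpan)]
    refine Finset.sum_congr rfl fun i _ => ?_
    rcases eq_or_ne i j with rfl | hi
    · simp [add_mul, Complex.exp_add, mul_comm Complex.I]
    · simp [hi]
  rw [hspikes, h.cintegral_spikes, Finset.sum_update_of_mem (Finset.mem_univ j),
    ← Finset.sum_erase_add _ _ (Finset.mem_univ j), Finset.sdiff_singleton_eq_erase]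
  congr 1
  ring

end IsDualCertificate

theorem mul_arccos_sub_sq_le {e x y : ℝ} (he : 0 < e) (hx : |x| ≤ 1 - e) (hy : |y| ≤ 1 - e) :
    e * |Real.arccos x - Real.arccos y| ^ 2 ≤ |x - y| ^ 2 := by
  have he1 : e ≤ 1 - (1 - e) ^ 2 := by nlinarith [abs_nonneg x]
  have h := pow_le_pow_left₀ (abs_nonneg _) (abs_arccos_sub_le (sub_lt_self 1 he) hx hy) 2
  rw [div_pow, Real.sq_sqrt (he.le.trans he1), le_div_iff₀ (he.trans_le he1)] at h
  exact (mul_comm _ _).trans_le ((by gcongr : _ ≤ _).trans h)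

theorem three_mul_sq_mul_arccos_sub_sq_le (hm : 2 ≤ m) (hc₀ : 0 < c₀) {x t : ℝ}
    (ht : |t| ≤ 1 - 2 * c₀) (hx : |x - t| ≤ c₀ / m) :
    3 * c₀ ^ 2 * |Real.arccos x - Real.arccos t| ^ 2 ≤ |x - t| ^ 2 := by
  have hc₁ : 2 * c₀ ≤ 1 := by linarith [abs_nonneg t]
  have hhalf : c₀ / m ≤ c₀ / 2 := by
    gcongr
    exact_mod_cast hm
  have hx' : |x| ≤ |x - t| + |t| := by simpa using abs_add_le (x - t) t
  refine le_trans ?_ (mul_arccos_sub_sq_le (e := 3 / 2 * c₀) (by positivity) (by linarith)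
    (by linarith))
  gcongr ?_ * _
  nlinarith

theorem abs_sub_le_of_mul_sq_le (hm : m ≠ 0) (hc₀ : 0 < c₀) (hCa : 0 < Ca)
    (hC : Cb / Ca ≤ c₀ ^ 2) {d : ℝ} (hd : Ca * m ^ 2 * d ^ 2 ≤ Cb) : d ≤ c₀ / m := by
  rw [le_div_iff₀ (by positivity)]
  refine le_of_sq_le_sq ((le_trans ?_ hC) : _ ≤ c₀ ^ 2) hc₀.le
  rw [le_div_iff₀ hCa]
  linarith

theorem QIC.separation (hm : m ≠ 0) (h : QIC m T Ca Cb) (hc₀ : 0 < c₀)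
    (hT : ∀ j, |(T j : ℝ)| ≤ 1 - 2 * c₀) {i j : Fin s} (hij : i ≠ j) :
    2 * (c₀ / m) < |(T i : ℝ) - T j| := by
  obtain ⟨P, hP⟩ := h.exists_isDualCertificate (Pi.single j Real.pi)
  have hi : P (T i) = 1 := by simp [hP.interpolates, hij]
  have hj : P (T j) = -1 := by
    simp [hP.interpolates, Complex.exp_neg, mul_comm Complex.I, Complex.exp_pi_mul_I]
  have hosc := norm_sub_le_mul_abs_arccos_sub hm hP.mem_chebSpan hP.norm_le_one (T i) (T j)
  have htwo : ‖(1 : ℂ) - -1‖ = 2 := by norm_num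
  rw [hi, hj, htwo] at hosc
  have harc := mul_arccos_sub_sq_le (by positivity) (hT i) (hT j)
  have hc₁ : 2 * c₀ ≤ 1 := by linarith [hT i, abs_nonneg (T i : ℝ)]
  set τ := |Real.arccos (T i) - Real.arccos (T j)|
  have hτ : 2 * c₀ * τ ≤ |(T i : ℝ) - T j| := by
    refine le_of_sq_le_sq (le_trans ?_ harc) (abs_nonneg _)
    rw [mul_pow]
    gcongr
    nlinarith
  have hm0 : (0 : ℝ) < m := by positivity
  rw [mul_div_assoc', div_lt_iff₀ hm0]
  nlinarith

namespace IsDualCertificate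

theorem norm_sub_sq_le_of_near (h : IsDualCertificate m T Ca Cb θ P) (hm : 2 ≤ m) (hc₀ : 0 < c₀)
    {k : Fin s} (hk : |(T k : ℝ)| ≤ 1 - 2 * c₀) {x : Dom} (hx : |(x : ℝ) - T k| ≤ c₀ / m) :
    ‖P x - P (T k)‖ ^ 2 ≤ m ^ 2 * |(x : ℝ) - T k| ^ 2 / (3 * c₀ ^ 2) := by
  have hosc := norm_sub_le_mul_abs_arccos_sub (by lia) h.mem_chebSpan h.norm_le_one x (T k)
  have harc := three_mul_sq_mul_arccos_sub_sq_le hm hc₀ hk hx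
  rw [mul_div_assoc]
  refine (pow_le_pow_left₀ (norm_nonneg _) hosc 2).trans ?_
  rw [mul_pow]
  gcongr
  rwa [le_div_iff₀' (by positivity)]

theorem one_sub_le_norm_of_near (h : IsDualCertificate m T Ca Cb θ P) (hm : 2 ≤ m) (hc₀ : 0 < c₀)
    {k : Fin s} (hk : |(T k : ℝ)| ≤ 1 - 2 * c₀) {x : Dom} (hx : |(x : ℝ) - T k| ≤ c₀ / m) :
    1 - m ^ 2 * |(x : ℝ) - T k| ^ 2 / (3 * c₀ ^ 2) ≤ ‖P x‖ := by
  refine le_trans (sub_le_sub_left ?_ 1) (one_sub_sq_le_norm_of_mem_chebSpan (by lia)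
    h.mem_chebSpan h.norm_le_one (h.norm_apply_eq_one k) x)
  have harc := three_mul_sq_mul_arccos_sub_sq_le hm hc₀ hk hx
  rw [mul_pow, mul_div_assoc]
  gcongr
  rwa [le_div_iff₀' (by positivity)]

end IsDualCertificate

theorem QIC.exists_dist_eq (hm : m ≠ 0) (h : QIC m T Ca Cb) (hc₀ : 0 < c₀)
    (hT : ∀ j, |(T j : ℝ)| ≤ 1 - 2 * c₀) (j : Fin s) {d : ℝ} (hd0 : 0 ≤ d) (hd : d ≤ c₀ / m) :
    ∃ x : Dom, |(x : ℝ) - T j| = d ∧ ∀ k, d ≤ |(x : ℝ) - T k| := by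
  have hdc : d ≤ c₀ := hd.trans (div_le_self hc₀.le (by exact_mod_cast Nat.one_le_iff_ne_zero.2 hm))
  obtain ⟨hlo, hhi⟩ := abs_le.1 (hT j)
  refine ⟨⟨T j + d, by linarith, by linarith⟩, by simpa using hd0, fun k => ?_⟩
  rcases eq_or_ne k j with rfl | hkj
  · simpa using le_abs_self d
  · have hsep := h.separation hm hc₀ hT hkj
    have htri := abs_sub_le (T k : ℝ) (T j + d) (T j)
    rw [add_sub_cancel_left, abs_of_nonneg hd0, abs_sub_comm _ (T j + d)] at htri
    linarith

/-- The isolation constant cannot be large, since the modulus of a certificate, equal to `1` at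
the points, varies slowly by Bernstein's inequality. -/
theorem QIC.le_third (hm : 2 ≤ m) (h : QIC m T Ca Cb) (hc₀ : 0 < c₀)
    (hT : ∀ j, |(T j : ℝ)| ≤ 1 - 2 * c₀) (hC : Cb / Ca ≤ c₀ ^ 2) (j : Fin s) : Cb ≤ 1 / 3 := by
  obtain ⟨hCa, hCb, -, -⟩ := id h
  obtain ⟨P, hP⟩ := h.exists_isDualCertificate 0
  have hm0 : (m : ℝ) ≠ 0 := Nat.cast_ne_zero.2 (by lia)
  set d := √(Cb / Ca) / m with hd
  have hdsq : m ^ 2 * d ^ 2 = Cb / Ca := by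
    rw [hd, ← mul_pow, mul_div_cancel₀ _ hm0, Real.sq_sqrt (by positivity)]
  have hCb_eq : Ca * m ^ 2 * d ^ 2 = Cb := by
    rw [mul_assoc, hdsq, mul_div_cancel₀ _ hCa.ne']
  have hdle : d ≤ c₀ / m := abs_sub_le_of_mul_sq_le (by lia) hc₀ hCa hC hCb_eq.le
  obtain ⟨x, hxj, hfar⟩ := h.exists_dist_eq (by lia) hc₀ hT j (by positivity) hdle
  have hupper : ‖P x‖ ≤ 1 - Cb := by
    refine hP.isolates x Cb le_rfl fun k => ?_
    rw [← hCb_eq]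
    have := hfar k
    gcongr
  have hlower := hP.one_sub_le_norm_of_near hm hc₀ (hT j) (hxj.trans_le hdle)
  rw [hxj, hdsq] at hlower
  have hratio : Cb / Ca / (3 * c₀ ^ 2) ≤ 1 / 3 := by
    rw [div_le_iff₀ (by positivity)]
    linarith
  linarith

end DualCertificate

section CombinedCertificate

theorem norm_one_add_smul_sub_le {p q : ℂ} {g L : ℝ} (hL : 0 ≤ L) (hp : ‖p‖ ≤ 1 - g)
    (hq : ‖q‖ ≤ 1 - g) (hLg : 2 ≤ (2 + L) * g) : ‖(1 + L) • p - q‖ ≤ L :=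
  calc ‖(1 + L) • p - q‖ ≤ (1 + L) * ‖p‖ + ‖q‖ := by
        refine (norm_sub_le _ _).trans_eq ?_
        rw [norm_smul, Real.norm_of_nonneg (by positivity)]
    _ ≤ (1 + L) * (1 - g) + (1 - g) := by gcongr
    _ ≤ L := by linarith

theorem norm_one_add_smul_sub_sq {E : Type*} [NormedAddCommGroup E] [InnerProductSpace ℝ E]
    (p q : E) (L : ℝ) : ‖(1 + L) • p - q‖ ^ 2 =
      (1 + L) * L * ‖p‖ ^ 2 - L * ‖q‖ ^ 2 + (1 + L) * ‖p - q‖ ^ 2 := by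
  rw [norm_sub_sq_real, norm_sub_sq_real, norm_smul, inner_smul_left, mul_pow, Real.norm_eq_abs,
    sq_abs, RCLike.conj_to_real]
  ring

theorem norm_one_add_smul_sub_le_of_close {E : Type*} [NormedAddCommGroup E]
    [InnerProductSpace ℝ E] {p q : E} {g w L : ℝ} (hL : 2 ≤ L) (hg : 0 ≤ g) (hp : ‖p‖ ≤ 1 - g)
    (hw : 0 ≤ w) (hq : 1 - w ≤ ‖q‖) (hpq : ‖p - q‖ ^ 2 ≤ 4 * w) (hLg : 9 * w ≤ (1 + L) * g) :
    ‖(1 + L) • p - q‖ ≤ L := by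
  refine le_of_sq_le_sq ?_ (by linarith)
  rw [norm_one_add_smul_sub_sq]
  have hp2 : ‖p‖ ^ 2 ≤ 1 - g := by nlinarith [norm_nonneg p]
  have hq2 : 1 - 2 * w ≤ ‖q‖ ^ 2 := by nlinarith [sq_nonneg (‖q‖ - 1)]
  calc (1 + L) * L * ‖p‖ ^ 2 - L * ‖q‖ ^ 2 + (1 + L) * ‖p - q‖ ^ 2
      ≤ (1 + L) * L * (1 - g) - L * (1 - 2 * w) + (1 + L) * (4 * w) := by gcongr
    _ = L ^ 2 - L * ((1 + L) * g) + (6 * L + 4) * w := by ring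
    _ ≤ L ^ 2 - L * (9 * w) + (6 * L + 4) * w := by gcongr
    _ ≤ L ^ 2 := by nlinarith

variable {m s : ℕ} {T : Fin s → Dom} {Ca Cb c₀ L : ℝ} {θ θ' : Fin s → ℝ} {P Q : Dom → ℂ}

theorem IsDualCertificate.norm_sub_sq_le_of_near_of_eq (hP : IsDualCertificate m T Ca Cb θ P)
    (hQ : IsDualCertificate m T Ca Cb θ' Q) (hm : 2 ≤ m) (hc₀ : 0 < c₀) {k : Fin s}
    (hk : |(T k : ℝ)| ≤ 1 - 2 * c₀) (hθ : θ' k = θ k) {x : Dom} (hx : |(x : ℝ) - T k| ≤ c₀ / m) :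
    ‖P x - Q x‖ ^ 2 ≤ 4 * (m ^ 2 * |(x : ℝ) - T k| ^ 2 / (3 * c₀ ^ 2)) := by
  have heq : P (T k) = Q (T k) := by rw [hP.interpolates, hQ.interpolates, hθ]
  have hsplit : P x - Q x = (P x - P (T k)) - (Q x - Q (T k)) := by rw [heq]; ring
  have hpar := parallelogram_law_with_norm ℝ (P x - P (T k)) (Q x - Q (T k))
  rw [hsplit]
  linarith [hP.norm_sub_sq_le_of_near hm hc₀ hk hx, hQ.norm_sub_sq_le_of_near hm hc₀ hk hx,
    mul_self_nonneg ‖P x - P (T k) + (Q x - Q (T k))‖]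

theorem IsDualCertificate.norm_one_add_smul_sub_le_of_near
    (hP : IsDualCertificate m T Ca Cb θ P) (hQ : IsDualCertificate m T Ca Cb θ' Q) (hm : 2 ≤ m)
    (hCa : 0 < Ca) (hc₀ : 0 < c₀) (hC : Cb / Ca ≤ c₀ ^ 2) (hL : 2 ≤ L) (hLCb : 3 ≤ (1 + L) * Cb)
    {k : Fin s} (hk : |(T k : ℝ)| ≤ 1 - 2 * c₀) (hθ : θ' k = θ k) {x : Dom}
    (hnear : Ca * m ^ 2 * |(x : ℝ) - T k| ^ 2 ≤ Cb)
    (hmin : ∀ l, Ca * m ^ 2 * |(x : ℝ) - T k| ^ 2 ≤ Ca * m ^ 2 * |(x : ℝ) - T l| ^ 2) :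
    ‖(1 + L) • P x - Q x‖ ≤ L := by
  have hx : |(x : ℝ) - T k| ≤ c₀ / m := abs_sub_le_of_mul_sq_le (by lia) hc₀ hCa hC hnear
  refine norm_one_add_smul_sub_le_of_close hL (by positivity) (hP.isolates x _ hnear hmin)
    (by positivity) (hQ.one_sub_le_norm_of_near hm hc₀ hk hx)
    (hP.norm_sub_sq_le_of_near_of_eq hQ hm hc₀ hk hθ hx) ?_
  have hLC : 3 ≤ (1 + L) * (c₀ ^ 2 * Ca) :=
    hLCb.trans (mul_le_mul_of_nonneg_left ((div_le_iff₀ hCa).1 hC) (by linarith))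
  rw [mul_div_assoc', div_le_iff₀ (by positivity)]
  calc 9 * (m ^ 2 * |(x : ℝ) - T k| ^ 2) = 3 * 3 * (m ^ 2 * |(x : ℝ) - T k| ^ 2) := by ring
    _ ≤ 3 * ((1 + L) * (c₀ ^ 2 * Ca)) * (m ^ 2 * |(x : ℝ) - T k| ^ 2) := by gcongr
    _ = _ := by ring

/-- Near a point where `P` and `Q` take the same value the two certificates stay close to each
other, so that the crude triangle bound, which is too weak there, can be improved. -/
theorem IsDualCertificate.norm_one_add_smul_sub_le (hP : IsDualCertificate m T Ca Cb θ P)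
    (hQ : IsDualCertificate m T Ca Cb θ' Q) (hm : 2 ≤ m) (hQIC : QIC m T Ca Cb) (hc₀ : 0 < c₀)
    (hT : ∀ j, |(T j : ℝ)| ≤ 1 - 2 * c₀) (hC : Cb / Ca ≤ c₀ ^ 2) {j : Fin s}
    (hθ : ∀ k, k ≠ j → θ' k = θ k) (hL : 4 * (1 - Cb) ≤ L * Cb) {x : Dom}
    (hx : 2 ≤ L * (Ca * m ^ 2 * |(x : ℝ) - T j| ^ 2)) : ‖(1 + L) • P x - Q x‖ ≤ L := by
  obtain ⟨hCa, hCb, -, -⟩ := id hQIC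
  have hthird := hQIC.le_third hm hc₀ hT hC j
  have hL8 : 8 ≤ L := by nlinarith
  have : Nonempty (Fin s) := ⟨j⟩
  obtain ⟨k, hk⟩ := Finite.exists_min fun k => Ca * (m : ℝ) ^ 2 * |(x : ℝ) - T k| ^ 2
  rcases le_total (Ca * m ^ 2 * |(x : ℝ) - T k| ^ 2) Cb with hnear | hfar
  · rcases eq_or_ne k j with rfl | hkj
    · refine MomentBlasso.norm_one_add_smul_sub_le (by linarith) (hP.isolates x _ hnear hk)
        (hQ.isolates x _ hnear hk) (hx.trans ?_)
      gcongr
      linarith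
    · exact hP.norm_one_add_smul_sub_le_of_near hQ hm hCa hc₀ hC (by linarith) (by linarith) (hT k)
        (hθ k hkj) hnear hk
  · have hge (l : Fin s) : Cb ≤ Ca * m ^ 2 * |(x : ℝ) - T l| ^ 2 := hfar.trans (hk l)
    exact MomentBlasso.norm_one_add_smul_sub_le (by linarith) (hP.isolates x Cb le_rfl hge)
      (hQ.isolates x Cb le_rfl hge) (by linarith)

end CombinedCertificate

section Recovery

variable {m s : ℕ} {T : Fin s → Dom} {a θ : Fin s → ℝ} {Ca Cb c₀ C' lam : ℝ}
  {y : Fin (m + 1) → ℂ} {μ : ComplexMeasure Dom} {P : Dom → ℂ}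

namespace IsDualCertificate

theorem tvNorm_spikes_sub_le (hP : IsDualCertificate m T Ca Cb θ P) (ha : ∀ j, 0 ≤ a j)
    (μ : ComplexMeasure Dom) : tvNorm (spikes T a θ) - (cintegral μ P).re ≤
      ‖momentVec m μ - momentVec m (spikes T a θ)‖ := by
  have hspikes : tvNorm (spikes T a θ) ≤ (cintegral (spikes T a θ) P).re := by
    rw [hP.cintegral_spikes, Complex.ofReal_re]
    exact tvNorm_spikes_le T θ ha
  have hbessel := norm_cintegral_le_mul_norm_momentVec hP.mem_chebSpan hP.norm_le_one
    (spikes T a θ - μ)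
  rw [one_mul, map_sub, norm_sub_rev, cintegral_sub_of_mem_chebSpan hP.mem_chebSpan] at hbessel
  have hre := (Complex.re_le_norm _).trans hbessel
  rw [Complex.sub_re] at hre
  linarith

variable (hP : IsDualCertificate m T Ca Cb θ P) (ha : ∀ j, 0 ≤ a j) (hlam : 0 < lam)
  (hy : ‖momentVec m (spikes T a θ) - WithLp.toLp 2 y‖ ≤ lam) (hμ : IsSolution m lam y μ)
include hP ha hlam hy hμ

theorem tvNorm_sub_re_cintegral_le : tvNorm μ - (cintegral μ P).re ≤ lam :=
  hμ.isPenalizedMin.sub_le tvSeminorm.convexOn hlam hy (hP.tvNorm_spikes_sub_le ha μ)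

theorem norm_momentVec_sub_le :
    ‖momentVec m μ - momentVec m (spikes T a θ)‖ ≤ 2 * lam := by
  refine hμ.isPenalizedMin.norm_sub_le tvSeminorm.convexOn hlam.le hy
    (hP.tvNorm_spikes_sub_le ha μ) ?_
  have h := re_cintegral_le_mul_tvNorm (continuous_of_mem_chebSpan hP.mem_chebSpan) μ
    fun x _ => hP.norm_le_one x
  rwa [one_mul] at h

end IsDualCertificate

theorem QIC.exists_mul_sq_le_of_large_atom (hQIC : QIC m T Ca Cb) (ha : ∀ j, 0 ≤ a j)
    (hlam : 0 < lam) (hy : ‖momentVec m (spikes T a θ) - WithLp.toLp 2 y‖ ≤ lam)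
    (hμ : IsSolution m lam y μ) {x : Dom} (hx : 2 * lam / Cb < ‖μ {x}‖) :
    ∃ k, Ca * m ^ 2 * |(x : ℝ) - T k| ^ 2 ≤ 2 * lam / ‖μ {x}‖ := by
  obtain ⟨P, hP⟩ := hQIC.exists_isDualCertificate θ
  have hatom : 0 < ‖μ {x}‖ := (div_pos (by positivity) hQIC.2.1).trans hx
  by_contra! hfar
  have hgap := hP.isolates x (2 * lam / ‖μ {x}‖) (div_le_comm₀ hQIC.2.1 hatom |>.1 hx.le)
    fun k => (hfar k).le
  have hdefect := (norm_singleton_mul_le_sub_re_cintegral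
    (continuous_of_mem_chebSpan hP.mem_chebSpan) μ hP.norm_le_one x).trans
    (hP.tvNorm_sub_re_cintegral_le ha hlam hy hμ)
  have hmass := (mul_le_mul_of_nonneg_left (le_sub_comm.1 hgap) hatom.le).trans hdefect
  rw [mul_div_cancel₀ _ hatom.ne'] at hmass
  linarith

theorem sqrt_div_mul_one_div_le (hCa : 0 < Ca) (hCb : 0 < Cb) (hc₀ : 0 < c₀)
    (hC : Cb / Ca ≤ c₀ ^ 2) (hlam : 0 < lam) {r : ℝ} (hr : 2 * lam / Cb < r) :
    √(2 * lam / (Ca * r)) * (1 / m) ≤ c₀ / m := by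
  have hr0 : 0 < r := (by positivity : 0 < 2 * lam / Cb).trans hr
  rw [mul_one_div]
  gcongr
  rw [Real.sqrt_le_left hc₀.le]
  refine le_trans ?_ hC
  rw [mul_comm Ca, ← div_div]
  gcongr
  exact (div_le_comm₀ hCb hr0).1 hr.le

theorem QIC.existsUnique_near_of_large_atom (hm : m ≠ 0) (hQIC : QIC m T Ca Cb) (hc₀ : 0 < c₀)
    (hT : ∀ j, |(T j : ℝ)| ≤ 1 - 2 * c₀) (hC : Cb / Ca ≤ c₀ ^ 2) (ha : ∀ j, 0 ≤ a j)
    (hlam : 0 < lam) (hy : ‖momentVec m (spikes T a θ) - WithLp.toLp 2 y‖ ≤ lam)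
    (hμ : IsSolution m lam y μ) {x : Dom} (hx : 2 * lam / Cb < ‖μ {x}‖) :
    ∃! t : Dom, t ∈ Set.range T ∧ |(x : ℝ) - t| ≤ √(2 * lam / (Ca * ‖μ {x}‖)) * (1 / m) := by
  obtain ⟨hCa, hCb, -, -⟩ := id hQIC
  have hradius := sqrt_div_mul_one_div_le (m := m) hCa hCb hc₀ hC hlam hx
  obtain ⟨k, hk⟩ := hQIC.exists_mul_sq_le_of_large_atom ha hlam hy hμ hx
  have hm0 : (0 : ℝ) < m := by positivity
  have hnear : |(x : ℝ) - T k| ≤ √(2 * lam / (Ca * ‖μ {x}‖)) * (1 / m) := by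
    rw [mul_one_div, le_div_iff₀ hm0]
    refine Real.le_sqrt_of_sq_le ?_
    rw [mul_comm Ca, ← div_div, le_div_iff₀ hCa]
    linarith
  refine ⟨T k, ⟨⟨k, rfl⟩, hnear⟩, ?_⟩
  rintro _ ⟨⟨l, rfl⟩, hl⟩
  by_contra hne
  have hsep := hQIC.separation hm hc₀ hT (ne_of_apply_ne T hne)
  have htri := abs_sub_le (T l : ℝ) x (T k)
  rw [abs_sub_comm (T l : ℝ) x] at htri
  linarith

theorem re_cintegral_smul_sub {Q : Dom → ℂ} (hP : Continuous P) (hQ : Continuous Q) (c : ℝ)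
    (μ : ComplexMeasure Dom) :
    (cintegral μ (c • P - Q)).re = c * (cintegral μ P).re - (cintegral μ Q).re := by
  have hsub : cintegral μ (c • P - Q) = c • cintegral μ P - cintegral μ Q := by
    unfold cintegral
    rw [VectorMeasure.integral_sub (integrable_of_continuous (by fun_prop))
      (integrable_of_continuous hQ), VectorMeasure.integral_smul]
  rw [hsub, Complex.sub_re, Complex.smul_re, smul_eq_mul]

/-- Pairing with `P` certifies the total variation of the solution, while pairing with `Q`, which
has the opposite sign at `T j`, loses `2 a j`. -/
theorem IsDualCertificate.amplitude_le [DecidableEq (Fin s)] {Q : Dom → ℂ} {j : Fin s}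
    (hP : IsDualCertificate m T Ca Cb θ P)
    (hQ : IsDualCertificate m T Ca Cb (Function.update θ j (θ j + Real.pi)) Q)
    (ha : ∀ j, 0 ≤ a j) (hlam : 0 < lam)
    (hy : ‖momentVec m (spikes T a θ) - WithLp.toLp 2 y‖ ≤ lam) (hμ : IsSolution m lam y μ)
    {L : ℝ} (hL0 : 0 ≤ L) (hL : ∀ x ∈ supp μ, ‖(1 + L) • P x - Q x‖ ≤ L) :
    a j ≤ (2 + L / 2) * lam := by
  have hmoment := hP.norm_momentVec_sub_le ha hlam hy hμ
  have hdefect := hP.tvNorm_sub_re_cintegral_le ha hlam hy hμ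
  have herror {R : Dom → ℂ} (hR : R ∈ chebSpan m) (hle : ∀ x, ‖R x‖ ≤ 1) :
      |(cintegral μ R).re - (cintegral (spikes T a θ) R).re| ≤ 2 * lam := by
    rw [← Complex.sub_re, ← cintegral_sub_of_mem_chebSpan hR]
    refine (Complex.abs_re_le_norm _).trans
      ((norm_cintegral_le_mul_norm_momentVec hR hle _).trans ?_)
    rwa [one_mul, map_sub]
  have hPμ := abs_le.1 (herror hP.mem_chebSpan hP.norm_le_one)
  have hQμ := abs_le.1 (herror hQ.mem_chebSpan hQ.norm_le_one)
  rw [hP.cintegral_spikes, Complex.ofReal_re] at hPμ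
  rw [hQ.cintegral_spikes_flip, Complex.ofReal_re] at hQμ
  have hPc := continuous_of_mem_chebSpan hP.mem_chebSpan
  have hQc := continuous_of_mem_chebSpan hQ.mem_chebSpan
  have hpair := re_cintegral_le_mul_tvNorm (P := (1 + L) • P - Q) (by fun_prop) μ hL
  rw [re_cintegral_smul_sub hPc hQc] at hpair
  linarith [mul_le_mul_of_nonneg_left hdefect hL0]

theorem QIC.exists_mem_supp_near_of_large_spike (hm : 2 ≤ m) (hQIC : QIC m T Ca Cb)
    (hc₀ : 0 < c₀) (hT : ∀ j, |(T j : ℝ)| ≤ 1 - 2 * c₀) (hC : Cb / Ca ≤ c₀ ^ 2)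
    (ha : ∀ j, 0 ≤ a j) (hlam : 0 < lam)
    (hy : ‖momentVec m (spikes T a θ) - WithLp.toLp 2 y‖ ≤ lam) (hμ : IsSolution m lam y μ)
    (hC' : 2 / Cb ≤ C') {j : Fin s} (hj : C' * lam < a j) :
    ∃ t ∈ supp μ, |(T j : ℝ) - t| ≤ √(2 * lam / (Ca * (a j - C' * lam))) * (1 / m) := by
  obtain ⟨hCa, hCb, hCb1, -⟩ := id hQIC
  obtain ⟨P, hP⟩ := hQIC.exists_isDualCertificate θ
  obtain ⟨Q, hQ⟩ := hQIC.exists_isDualCertificate (Function.update θ j (θ j + Real.pi))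
  have hm0 : (0 : ℝ) < m := by positivity
  have hexcess : 0 < a j - C' * lam := sub_pos.2 hj
  rw [div_le_iff₀ hCb] at hC'
  have htwo_lt : 2 < C' := by nlinarith
  -- With this weight the bound `a j ≤ (2 + L / 2) * lam` fails by half of the excess.
  set L := (a j - C' * lam) / lam + 2 * (C' - 2) with hL
  have hLlam : L * lam = a j - C' * lam + 2 * (C' - 2) * lam := by
    rw [hL, add_mul, div_mul_cancel₀ _ hlam.ne']
  have hLge : 2 * (C' - 2) ≤ L := le_add_of_nonneg_left (by positivity)
  have hLexcess : a j - C' * lam ≤ L * lam := by nlinarith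
  by_contra! hfar
  have hsupp : ∀ x ∈ supp μ, ‖(1 + L) • P x - Q x‖ ≤ L := by
    intro x hx
    refine hP.norm_one_add_smul_sub_le hQ hm hQIC hc₀ hT hC (j := j)
      (fun k hk => Function.update_of_ne hk _ _)
      (by linarith [mul_le_mul_of_nonneg_right hLge hCb.le]) ?_
    have hdist := hfar x hx
    rw [mul_one_div, div_lt_iff₀ hm0, abs_sub_comm] at hdist
    replace hdist := Real.lt_sq_of_sqrt_lt hdist
    rw [div_lt_iff₀ (by positivity)] at hdist
    refine le_of_mul_le_mul_right ?_ hlam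
    calc 2 * lam ≤ (a j - C' * lam) * (Ca * m ^ 2 * |(x : ℝ) - T j| ^ 2) := by linarith
      _ ≤ L * lam * (Ca * m ^ 2 * |(x : ℝ) - T j| ^ 2) := by gcongr
      _ = _ := by ring
  have hamp := hP.amplitude_le hQ ha hlam hy hμ (by linarith) hsupp
  linarith

end Recovery

section Noise

variable {Ω : Type*} [MeasurableSpace Ω] {Pr : Measure Ω}

theorem hasSubgaussianMGF_of_hasLaw_gaussianReal {X : Ω → ℝ} {v : NNReal}
    (hX : HasLaw X (gaussianReal 0 v) Pr) : HasSubgaussianMGF X v Pr where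
  integrable_exp_mul t := by
    have h := integrable_exp_mul_gaussianReal (μ := 0) (v := v) t
    rw [← hX.map_eq] at h
    exact h.comp_aemeasurable hX.aemeasurable
  mgf_le t := by simp [mgf_gaussianReal hX.map_eq]

theorem measureReal_le_abs_le [IsFiniteMeasure Pr] {X : Ω → ℝ} {v : NNReal}
    (hX : HasSubgaussianMGF X v Pr) {c : ℝ} (hc : 0 ≤ c) :
    Pr.real {ω | c ≤ |X ω|} ≤ 2 * Real.exp (-c ^ 2 / (2 * v)) :=
  calc Pr.real {ω | c ≤ |X ω|} = Pr.real ({ω | c ≤ X ω} ∪ {ω | c ≤ (-X) ω}) := by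
        simp only [le_abs, Pi.neg_apply, Set.ofPred_or]
    _ ≤ Pr.real {ω | c ≤ X ω} + Pr.real {ω | c ≤ (-X) ω} := measureReal_union_le _ _
    _ ≤ Real.exp (-c ^ 2 / (2 * v)) + Real.exp (-c ^ 2 / (2 * v)) :=
        add_le_add (hX.measure_ge_le hc) (hX.neg.measure_ge_le hc)
    _ = _ := (two_mul _).symm

theorem measureReal_sum_sq_le [IsFiniteMeasure Pr] {ι : Type*} [Fintype ι] {X : ι → Ω → ℝ}
    {v : NNReal} (hX : ∀ i, HasSubgaussianMGF (X i) v Pr) {t : ℝ} (ht : 0 ≤ t) :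
    Pr.real {ω | t ^ 2 < ∑ i, X i ω ^ 2} ≤
      2 * Fintype.card ι * Real.exp (-(t ^ 2 / (2 * v * Fintype.card ι))) := by
  set n : ℝ := (Fintype.card ι : ℝ)
  have hsq : (t / √n) ^ 2 = t ^ 2 / n := by rw [div_pow, Real.sq_sqrt (Nat.cast_nonneg _)]
  have hsubset : {ω | t ^ 2 < ∑ i, X i ω ^ 2} ⊆ ⋃ i, {ω | t / √n ≤ |X i ω|} := by
    intro ω hω
    by_contra hsmall
    simp only [Set.mem_iUnion, Set.mem_ofPred_eq, not_exists, not_le] at hsmall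
    refine (lt_irrefl (t ^ 2)) (hω.trans_le ?_)
    calc ∑ i, X i ω ^ 2 ≤ ∑ _i : ι, (t / √n) ^ 2 := by
          refine Finset.sum_le_sum fun i _ => ?_
          rw [← sq_abs]
          exact pow_le_pow_left₀ (abs_nonneg _) (hsmall i).le 2
      _ = t ^ 2 * (n / n) := by
          rw [Finset.sum_const, Finset.card_univ, nsmul_eq_mul, hsq, mul_div_left_comm]
      _ ≤ t ^ 2 := mul_le_of_le_one_right (sq_nonneg t) (div_self_le_one n)
  calc Pr.real {ω | t ^ 2 < ∑ i, X i ω ^ 2} ≤ ∑ i, Pr.real {ω | t / √n ≤ |X i ω|} :=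
        (measureReal_mono hsubset).trans (measureReal_iUnion_fintype_le _)
    _ ≤ ∑ _i : ι, 2 * Real.exp (-(t / √n) ^ 2 / (2 * v)) :=
        Finset.sum_le_sum fun i _ => measureReal_le_abs_le (hX i) (by positivity)
    _ = _ := by
        rw [Finset.sum_const, Finset.card_univ, nsmul_eq_mul, hsq, neg_div, div_div,
          mul_comm n (2 * (v : ℝ))]
        ring

theorem six_le_eight_mul_sqrt_six_div_sqrt_two_mul_pi :
    6 ≤ 8 * √6 / √(2 * Real.pi) := by
  rw [le_div_iff₀ (Real.sqrt_pos.2 Real.two_pi_pos)]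
  refine le_of_sq_le_sq ?_ (by positivity)
  rw [mul_pow, mul_pow, Real.sq_sqrt Real.two_pi_pos.le, Real.sq_sqrt (by norm_num)]
  linarith [Real.pi_lt_four]

variable {m : ℕ} {σ lam : ℝ}

theorem log_two_le_log (hm : 2 ≤ m) : Real.log 2 ≤ Real.log m :=
  Real.log_le_log two_pos (by exact_mod_cast hm)

theorem lamM_pos (hm : 2 ≤ m) (hσ : 0 < σ) : 0 < lamM m σ := by
  have hlog : 0 < Real.log m := (Real.log_pos one_lt_two).trans_le (log_two_le_log hm)
  have hm0 : (0 : ℝ) < m := Nat.cast_pos.2 (by lia)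
  exact mul_pos hσ (Real.sqrt_pos.2 (mul_pos (mul_pos (by norm_num) hm0) hlog))

theorem neg_div_le_of_lamM (hm : 2 ≤ m) (hσ : 0 < σ) (lam : ℝ) :
    -(lam ^ 2 / (2 * σ ^ 2 * (m + 1))) ≤ -(2 * (lam ^ 2 / lamM m σ ^ 2) * Real.log m) := by
  have hlog : 0 < Real.log m := (Real.log_pos one_lt_two).trans_le (log_two_le_log hm)
  have hmR : (2 : ℝ) ≤ m := by exact_mod_cast hm
  rw [lamM, mul_pow, Real.sq_sqrt (by positivity), neg_le_neg_iff]
  calc 2 * (lam ^ 2 / (σ ^ 2 * (6 * m * Real.log m))) * Real.log m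
      = lam ^ 2 / (σ ^ 2 * (3 * m)) := by field_simp; ring
    _ ≤ lam ^ 2 / (2 * σ ^ 2 * (m + 1)) := by
        refine div_le_div_of_nonneg_left (sq_nonneg _) (by positivity) ?_
        nlinarith [sq_nonneg σ]

theorem noise_bound_lt (hm : 2 ≤ m) (hσ : 0 < σ) (hlam : lamM m σ ≤ lam) :
    2 * (m + 1) * Real.exp (-(lam ^ 2 / (2 * σ ^ 2 * (m + 1)))) <
      8 * √6 / √(2 * Real.pi) * (lam / lamM m σ) * √(Real.log m) *
        Real.exp (-((2 * (lam ^ 2 / lamM m σ ^ 2) - 1) * Real.log m)) := by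
  have hmR : (2 : ℝ) ≤ m := by exact_mod_cast hm
  have hratio : 1 ≤ lam / lamM m σ := (one_le_div (lamM_pos hm hσ)).2 hlam
  have hlog : 2 / 3 ≤ √(Real.log m) := by
    refine Real.le_sqrt_of_sq_le (le_trans ?_ (log_two_le_log hm))
    linarith [Real.log_two_gt_d9]
  set E := Real.exp (-(2 * (lam ^ 2 / lamM m σ ^ 2) * Real.log m))
  have hexp : Real.exp (-((2 * (lam ^ 2 / lamM m σ ^ 2) - 1) * Real.log m)) = m * E := by
    rw [sub_mul, one_mul, neg_sub, sub_eq_add_neg, Real.exp_add, Real.exp_log (by positivity)]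
  have hE0 : 0 < E := Real.exp_pos _
  rw [hexp]
  calc 2 * ((m : ℝ) + 1) * Real.exp (-(lam ^ 2 / (2 * σ ^ 2 * (m + 1)))) ≤ 2 * (m + 1) * E := by
        gcongr
        exact Real.exp_le_exp.2 (neg_div_le_of_lamM hm hσ lam)
    _ < 6 * 1 * (2 / 3) * (m * E) := by nlinarith
    _ ≤ _ := by
        gcongr
        exact six_le_eight_mul_sqrt_six_div_sqrt_two_mul_pi

theorem exists_measurableSet_norm_le [IsProbabilityMeasure Pr] {ε : Fin (m + 1) → Ω → ℝ}
    (hm : 2 ≤ m) (hσ : 0 < σ) (hε : ∀ k, HasSubgaussianMGF (ε k) (σ ^ 2).toNNReal Pr)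
    (hlam : lamM m σ ≤ lam) :
    ∃ E : Set Ω, MeasurableSet E ∧
      1 - 8 * √6 / √(2 * Real.pi) * (lam / lamM m σ) * √(Real.log m) *
          Real.exp (-((2 * (lam ^ 2 / lamM m σ ^ 2) - 1) * Real.log m)) < Pr.real E ∧
      ∀ ω ∈ E, ∑ k, ε k ω ^ 2 ≤ lam ^ 2 := by
  have htail := measureReal_sum_sq_le hε ((lamM_pos hm hσ).le.trans hlam)
  rw [Real.coe_toNNReal _ (sq_nonneg σ), Fintype.card_fin, Nat.cast_add_one] at htail
  set bad := {ω | lam ^ 2 < ∑ k, ε k ω ^ 2}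
  refine ⟨(toMeasurable Pr bad)ᶜ, (measurableSet_toMeasurable _ _).compl, ?_, fun ω hω => ?_⟩
  · rw [probReal_compl_eq_one_sub (measurableSet_toMeasurable _ _), measureReal_def,
      measure_toMeasurable, ← measureReal_def]
    linarith [noise_bound_lt hm hσ hlam]
  · exact not_lt.1 fun hbad => hω (subset_toMeasurable _ _ hbad)

end Noise

theorem abs_le_of_two_mul_le_abs_sub {t : Dom} {c₀ : ℝ}
    (ht : 2 * c₀ ≤ |(t : ℝ) - 1| ∧ 2 * c₀ ≤ |(t : ℝ) - (-1)|) : |(t : ℝ)| ≤ 1 - 2 * c₀ := by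
  rw [abs_of_nonpos (sub_nonpos.2 t.2.2), abs_of_nonneg (sub_nonneg.2 t.2.1)] at ht
  exact abs_le.2 ⟨by linarith, by linarith⟩

theorem norm_momentVec_sub_le {m : ℕ} {lam : ℝ} (hlam : 0 ≤ lam) (μ : ComplexMeasure Dom)
    {e : Fin (m + 1) → ℝ} (he : ∑ k, e k ^ 2 ≤ lam ^ 2) :
    ‖momentVec m μ - WithLp.toLp 2 (fun k : Fin (m + 1) => moment k μ + (e k : ℂ))‖ ≤ lam := by
  rw [EuclideanSpace.norm_eq, Real.sqrt_le_left hlam]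
  simpa [momentVec] using he

theorem two_div_le_constC' (Ca : ℝ) {Cb : ℝ} (hCb : 0 < Cb) : 2 / Cb ≤ constC' Ca Cb :=
  calc 2 / Cb = 2 + 2 * (1 - Cb) / Cb := by field_simp; ring
    _ ≤ constC' Ca Cb := add_le_add_right (le_max_left _ _) 2

end MomentBlasso

end

open MomentBlasso in
theorem mainTheorem4_general {Ω : Type*} [MeasurableSpace Ω] (Pr : Measure Ω)
    [IsProbabilityMeasure Pr] {m : ℕ} (hm : 2 ≤ m) {s : ℕ} {T : Fin s → Dom}
    {a : Fin s → ℝ} (θ : Fin s → ℝ) (ha : ∀ j, 0 ≤ a j)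
    {c₀ Ca Cb C' : ℝ} (hc₀ : 0 < c₀)
    (hedge : ∀ j, 2 * c₀ ≤ |(T j : ℝ) - 1| ∧ 2 * c₀ ≤ |(T j : ℝ) - (-1)|)
    (hQIC : QIC m T Ca Cb) (hC : Cb / Ca ≤ c₀ ^ 2) (hC' : 2 / Cb ≤ C')
    {σ : ℝ} (hσ : 0 < σ) {ε : Fin (m + 1) → Ω → ℝ}
    (hε : ∀ k, HasSubgaussianMGF (ε k) (σ ^ 2).toNNReal Pr)
    {lam : ℝ} (hlam : lamM m σ ≤ lam) :
    ∃ E : Set Ω, MeasurableSet E ∧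
      1 - 8 * √6 / √(2 * Real.pi) * (lam / lamM m σ) * √(Real.log m) *
          Real.exp (-((2 * (lam ^ 2 / lamM m σ ^ 2) - 1) * Real.log m)) < Pr.real E ∧
      ∀ ω ∈ E, ∀ Δhat : ComplexMeasure Dom,
        IsSolution m lam (fun k => moment k (spikes T a θ) + (ε k ω : ℂ)) Δhat →
        (∀ x : Dom, 2 * lam / Cb < ‖Δhat {x}‖ →
          (∃! t : Dom, t ∈ Set.range T ∧
            |(x : ℝ) - t| ≤ √(2 * lam / (Ca * ‖Δhat {x}‖)) * (1 / m)) ∧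
          √(2 * lam / (Ca * ‖Δhat {x}‖)) * (1 / m) ≤ c₀ / m) ∧
        (∀ j, C' * lam < a j → ∃ t ∈ supp Δhat,
          |(T j : ℝ) - t| ≤ √(2 * lam / (Ca * (a j - C' * lam))) * (1 / m)) := by
  have hlam0 : 0 < lam := (lamM_pos hm hσ).trans_le hlam
  have hT j := abs_le_of_two_mul_le_abs_sub (hedge j)
  obtain ⟨E, hE, hPr, hnoise⟩ := exists_measurableSet_norm_le hm hσ hε hlam
  refine ⟨E, hE, hPr, fun ω hω Δhat hsol => ?_⟩
  have hy := norm_momentVec_sub_le hlam0.le (spikes T a θ) (hnoise ω hω)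
  refine ⟨fun x hx => ⟨?_, ?_⟩, fun j hj => ?_⟩
  · exact hQIC.existsUnique_near_of_large_atom (by lia) hc₀ hT hC ha hlam0 hy hsol hx
  · exact sqrt_div_mul_one_div_le hQIC.1 hQIC.2.1 hc₀ hC hlam0 hx
  · exact hQIC.exists_mem_supp_near_of_large_spike hm hc₀ hT hC ha hlam0 hy hsol hC' hj

theorem mainTheorem4 {Ω : Type*} [MeasurableSpace Ω] (Pr : Measure Ω) [IsProbabilityMeasure Pr]
    (m : ℕ) (hm : 9 ≤ m)
    (s : ℕ) (T : Fin s → MomentBlasso.Dom) (hT : Function.Injective T)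
    (a θ : Fin s → ℝ) (ha : ∀ j, 0 < a j)
    (c₀ Ca Cb : ℝ) (hc₀ : 0 < c₀)
    (hedge : ∀ j, 2 * c₀ ≤ |(T j : ℝ) - 1| ∧ 2 * c₀ ≤ |(T j : ℝ) - (-1)|)
    (hQIC : MomentBlasso.QIC m T Ca Cb) (hC : Cb / Ca ≤ c₀ ^ 2)
    (σ : ℝ) (hσ : 0 < σ)
    (ε : Fin (m + 1) → Ω → ℝ) (hindep : iIndepFun ε Pr)
    (hgauss : ∀ k, HasLaw (ε k) (gaussianReal 0 (σ ^ 2).toNNReal) Pr)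
    (lam : ℝ) (hlam : MomentBlasso.lamM m σ ≤ lam) :
    ∃ E : Set Ω, MeasurableSet E ∧
      1 - 8 * Real.sqrt 6 / Real.sqrt (2 * Real.pi) * (lam / MomentBlasso.lamM m σ) *
          Real.sqrt (Real.log m) *
          Real.exp (-((2 * (lam ^ 2 / MomentBlasso.lamM m σ ^ 2) - 1) * Real.log m))
        < Pr.real E ∧
      ∀ ω ∈ E, ∀ Δhat : ComplexMeasure MomentBlasso.Dom,
        MomentBlasso.IsSolution m lam
          (fun k => MomentBlasso.moment k (MomentBlasso.spikes T a θ) + (ε k ω : ℂ)) Δhat →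
        (∀ x : MomentBlasso.Dom, 2 * lam / Cb < ‖Δhat {x}‖ →
          (∃! t : MomentBlasso.Dom, t ∈ Set.range T ∧
            |(x : ℝ) - t| ≤ Real.sqrt (2 * lam / (Ca * ‖Δhat {x}‖)) * (1 / m)) ∧
          Real.sqrt (2 * lam / (Ca * ‖Δhat {x}‖)) * (1 / m) ≤ c₀ / m) ∧
        (∀ j, MomentBlasso.constC' Ca Cb * lam < a j →
          ∃ t ∈ MomentBlasso.supp Δhat,
            |(T j : ℝ) - t| ≤
              Real.sqrt (2 * lam / (Ca * (a j - MomentBlasso.constC' Ca Cb * lam))) * (1 / m)) :=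
  mainTheorem4_general Pr (by lia) θ (fun j => (ha j).le) hc₀ hedge hQIC hC
    (MomentBlasso.two_div_le_constC' Ca hQIC.2.1) hσ
    (fun k => MomentBlasso.hasSubgaussianMGF_of_hasLaw_gaussianReal (hgauss k)) hlam
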